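/- **Resource complexity for hybrid Hamiltonian evolution.** *Setting.* Consider one oscillator with Fock cutoff $N$ (the span of $|0\rangle,\dots,|N-1\rangle$) and $m$ qubits. Let $\hat x=\hat a+\hat a^\dagger$, let $\hat x_N=\Pi_N\hat x\Pi_N$ with $\Pi_N=\sum_{\ell<N}|\ell\rangle\langle\ell|$, and let $\|\hat x\|_N:=\|\hat x_N\|$; all norms are operator norms. Let $L=\sum_{i=1}^{N_L}\alpha_iP_i$ and $H=\sum_{j=1}^{N_H}\beta_jQ_j$ with real coefficients and $m$-qubit Pauli strings $P_i,Q_j$. On the truncated hybrid space put $$H_{\rm hyb}=\hat x_N\otimes L+\mathbb I\otimes H,\qquad A_i=\alpha_i\hat x_N\otimes P_i,\qquad B_j=\beta_j\mathbb I\otimes Q_j .$$ *Formulas.* A Suzuki–Trotter formula $S$ is a finite sequence of blocks, each with a real time fraction $c$. On an ordered list of summands $G_1,\dots,G_n$ (here $A_1,\dots,A_{N_L},B_1,\dots,B_{N_H}$) and a time $s$, a block applies the exponentials $e^{-icsG_k}$ in the order $1,\dots,n$, or in the order $n,\dots,1$, or it is the symmetric block $e^{-icsG_1/2}\cdots e^{-icsG_{n-1}/2}\,e^{-icsG_n}\,e^{-icsG_{n-1}/2}\cdots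 e^{-icsG_1/2}$. It has order $p$ if $S(s)=e^{-is\sum_kG_k}+O(s^{p+1})$ as $s\to0$ for all finite lists of Hermitian matrices. Write $S_p$ for a formula of order $p\ge1$, and let $m_p$ be its number of exponentials when the Hamiltonian is split into two summands. *Commutator sums.* For $1\le a\le p$ let $$\Gamma_{p,a}^{(L,H)}=\sum_{R_1,\dots,R_{p+1}}\big\|[R_{p+1},[R_p,\cdots,[R_2,R_1]\cdots]]\big\|,$$ the sum being over words in the qubit operators $\alpha_iP_i$ $(1\le i\le N_L)$ and $\beta_jQ_j$ $(1\le j\le N_H)$ with exactly $a$ letters of the first kind and $p+1-a$ of the second, and let $$\Gamma_p^{(L)}=\sum_{i_1,\dots,i_{p+1}}|\alpha_{i_1}\cdots\alpha_{i_{p+1}}|\,\big\|[P_{i_{p+1}},[\cdots,[P_{i_2},P_{i_1}]\cdots]]\big\|,\qquad \Gamma_p^{(H)}=\sum_{j_1,\dots,j_{p+1}}|\beta_{j_1}\cdots\beta_{j_{p+1}}|\,\big\|[Q_{j_{p+1}},[\cdots,[Q_{j_2},Q_{j_1}]\cdots]]\big\|.$$ *Claim.* (1) For every $p\ge1$ and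 every Suzuki–Trotter formula $S_p$ of order $p$ there is a constant $C>0$, depending only on the formula and on $p$, such that for all $N,m,N_L,N_H$, all $L,H$ as above, all $t\ge0$ and $\epsilon_t>0$: every integer $$n_t\ \ge\ \max\left\{1,\ C\,t^{1+1/p}\left(\frac{\sum_{a=1}^p\|\hat x\|_N^a\,\Gamma_{p,a}^{(L,H)}+\|\hat x\|_N^{p+1}\,\Gamma_p^{(L)}+\Gamma_p^{(H)}}{\epsilon_t}\right)^{1/p}\right\}$$ satisfies $\big\|e^{-iH_{\rm hyb}t}-[S_p(t/n_t)]^{n_t}\big\|\le\epsilon_t$. (2) For every integer $n_t\ge1$, $[S_p(t/n_t)]^{n_t}$ is implemented exactly by a circuit of single-qubit unitaries, CNOTs, hybrid gates (qubit-controlled displacements $e^{-i\theta\hat x_N\otimes Z_q}$ and displacements $e^{-i\theta\hat x_N}$) and global phases, with $$N_{\rm CNOT}\le 2n_tm_p\Big[\sum_{i=1}^{N_L}\max(w(P_i)-1,0)+\sum_{j=1}^{N_H}\max(w(Q_j)-1,0)\Big],\qquad N_{\rm hyb}\le n_tm_pN_L,$$ where $w$ is the Pauli weight (number of non-identity tensor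 factors). (3) This covers the standard formulas: the Lie–Trotter formula has order $1$, and for $k\ge1$ the recursive Suzuki formula $S_{2k}$ has order $2k$ and $m_{2k}=3\cdot5^{k-1}$. Here $S_2$ is the symmetric block with $c=1$, and for $k\ge2$, $S_{2k}(s)=S_{2k-2}(us)^2\,S_{2k-2}((1-4u)s)\,S_{2k-2}(us)^2$ with $u=1/(4-4^{1/(2k-1)})$. -/

import Mathlib

open scoped Matrix Kronecker Matrix.Norms.L2Operator

noncomputable section

namespace Hybrid

/-! ### Pauli strings on `m` qubits

The register of `m` qubits is `ℂ^(Fin m → Fin 2)` (computational basis indexed by bit strings).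
All matrix norms are the operator norm induced by the Euclidean norm. -/

/-- The four single-qubit Pauli labels. -/
inductive Pauli
  | I
  | X
  | Y
  | Z
  deriving DecidableEq

/-- The `2 × 2` matrix of a Pauli label. -/
def Pauli.toMatrix : Pauli → Matrix (Fin 2) (Fin 2) ℂ
  | .I => 1
  | .X => !![0, 1; 1, 0]
  | .Y => !![0, -Complex.I; Complex.I, 0]
  | .Z => !![1, 0; 0, -1]

/-- Basis states of an `m`-qubit register. -/
abbrev Bits (m : ℕ) : Type := Fin m → Fin 2

/-- A Pauli string on `m` qubits. -/
abbrev PauliString (m : ℕ) : Type := Fin m → Pauli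

/-- The matrix of a Pauli string: the tensor product of its single-qubit Pauli matrices. -/
def PauliString.toMatrix {m : ℕ} (P : PauliString m) : Matrix (Bits m) (Bits m) ℂ :=
  Matrix.of fun x y => ∏ q, (P q).toMatrix (x q) (y q)

/-- The Pauli weight: the number of qubits on which the string is not the identity. -/
def PauliString.weight {m : ℕ} (P : PauliString m) : ℕ :=
  (Finset.univ.filter fun q => P q ≠ Pauli.I).card

/-- A real linear combination `∑ i, coeff i • string i` of `n` Pauli strings on `m` qubits. -/
structure PauliSum (m n : ℕ) where
  /-- the real coefficients -/
  coeff : Fin n → ℝ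
  /-- the Pauli strings -/
  string : Fin n → PauliString m

/-- The summand `coeff i • string i`, as an operator on the qubits. -/
def PauliSum.term {m n : ℕ} (A : PauliSum m n) (i : Fin n) : Matrix (Bits m) (Bits m) ℂ :=
  (A.coeff i : ℂ) • (A.string i).toMatrix

/-- The operator with the given Pauli decomposition. -/
def PauliSum.toMatrix {m n : ℕ} (A : PauliSum m n) : Matrix (Bits m) (Bits m) ℂ :=
  ∑ i, A.term i

/-- `∑ i, max (w(P_i) - 1) 0` (natural-number subtraction truncates at `0`). -/
def PauliSum.ladderWeight {m n : ℕ} (A : PauliSum m n) : ℕ :=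
  ∑ i, ((A.string i).weight - 1)

/-! ### The oscillator -/

/-- The annihilation operator `a` in the Fock basis: `a |j⟩ = √j |j - 1⟩`. -/
def annihilation : Matrix ℕ ℕ ℂ :=
  Matrix.of fun i j => if j = i + 1 then ((Real.sqrt j : ℝ) : ℂ) else 0

/-- The position operator `x̂ = a + a†` in the Fock basis (convention `ħ = 2`). -/
def position : Matrix ℕ ℕ ℂ := annihilation + annihilationᴴ

/-- The position operator at Fock cutoff `N`: `Π_N x̂ Π_N` on the span of `|0⟩, …, |N - 1⟩`. -/
def positionTrunc (N : ℕ) : Matrix (Fin N) (Fin N) ℂ :=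
  position.submatrix Fin.val Fin.val

/-- `‖x̂‖_N = ‖Π_N x̂ Π_N‖`. -/
def positionNorm (N : ℕ) : ℝ := ‖positionTrunc N‖

/-! ### The hybrid Hamiltonian and its summands -/

/-- Operators on the oscillator with cutoff `N` tensored with `m` qubits. -/
abbrev HybridOp (N m : ℕ) : Type := Matrix (Fin N × Bits m) (Fin N × Bits m) ℂ

/-- `H_hyb = x̂ ⊗ L + 1 ⊗ H`. -/
def hybridHamiltonian (N : ℕ) {m : ℕ} (L H : Matrix (Bits m) (Bits m) ℂ) : HybridOp N m :=
  positionTrunc N ⊗ₖ L + (1 : Matrix (Fin N) (Fin N) ℂ) ⊗ₖ H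

/-- The summands `A_1, …, A_{N_L}, B_1, …, B_{N_H}` with `A_i = α_i x̂ ⊗ P_i` and
`B_j = β_j 1 ⊗ Q_j`, in the order in which one layer applies them. -/
def summands (N : ℕ) {m NL NH : ℕ} (L : PauliSum m NL) (H : PauliSum m NH) :
    List (HybridOp N m) :=
  List.ofFn (fun i => positionTrunc N ⊗ₖ L.term i) ++
    List.ofFn (fun j => (1 : Matrix (Fin N) (Fin N) ℂ) ⊗ₖ H.term j)

/-! ### Commutator sums -/

/-- `[R_{p+1}, [R_p, ⋯ [R_2, R_1] ⋯ ]]`, where `R_k` is `R (k - 1)`. -/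
def nestedCommutator {M : Type*} [Ring M] : (p : ℕ) → (Fin (p + 1) → M) → M
  | 0, R => R 0
  | p + 1, R => ⁅R (Fin.last (p + 1)), nestedCommutator p (fun k => R k.castSucc)⁆

/-- The pure sum `∑ |α_{i_1} ⋯ α_{i_{p+1}}| ‖[P_{i_{p+1}}, [ ⋯ [P_{i_2}, P_{i_1}] ⋯ ]]‖`. -/
def pureSum {m n : ℕ} (p : ℕ) (A : PauliSum m n) : ℝ :=
  ∑ i : Fin (p + 1) → Fin n,
    |∏ k, A.coeff (i k)| * ‖nestedCommutator p fun k => (A.string (i k)).toMatrix‖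

/-- The mixed sum of `‖[R_{p+1}, [ ⋯ [R_2, R_1] ⋯ ]]‖` over the words in the qubit operators
`{α_i P_i} ∪ {β_j Q_j}` with exactly `a` letters `α_i P_i` and `p + 1 - a` letters `β_j Q_j`. -/
def mixedSum {m NL NH : ℕ} (p a : ℕ) (L : PauliSum m NL) (H : PauliSum m NH) : ℝ :=
  ∑ w : Fin (p + 1) → Fin NL ⊕ Fin NH with
      (Finset.univ.filter fun k => (w k).isLeft = true).card = a,
    ‖nestedCommutator p fun k => Sum.elim L.term H.term (w k)‖

/-- `∑_{a=1}^p ‖x̂‖_N^a Γ_{p,a}^{(L,H)} + ‖x̂‖_N^{p+1} Γ_p^{(L)} + Γ_p^{(H)}`. -/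
def commutatorBound (N p : ℕ) {m NL NH : ℕ} (L : PauliSum m NL) (H : PauliSum m NH) : ℝ :=
  ∑ a ∈ Finset.Icc 1 p, positionNorm N ^ a * mixedSum p a L H +
    positionNorm N ^ (p + 1) * pureSum p L + pureSum p H

/-! ### Suzuki–Trotter formulas -/

/-- A building block of a Suzuki–Trotter formula, with its time fraction `c`. -/
inductive Block
  /-- `e^{-i c s H_1}, e^{-i c s H_2}, …, e^{-i c s H_n}` -/
  | lie (c : ℝ)
  /-- `e^{-i c s H_n}, …, e^{-i c s H_2}, e^{-i c s H_1}` -/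
  | lieRev (c : ℝ)
  /-- `e^{-i c s H_1 / 2}, …, e^{-i c s H_n}, …, e^{-i c s H_1 / 2}` -/
  | strang (c : ℝ)

/-- Exponentials of the symmetric block, with the two middle ones fused into one. -/
def strangFactors {α : Type*} (c : ℝ) : List α → List (α × ℝ)
  | [] => []
  | [a] => [(a, c)]
  | a :: b :: l => (a, c / 2) :: (strangFactors c (b :: l) ++ [(a, c / 2)])

/-- The exponentials of a block, as pairs (summand, time fraction), in order of application. -/
def Block.factors {α : Type*} (l : List α) : Block → List (α × ℝ)
  | .lie c => l.map fun a => (a, c)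
  | .lieRev c => l.reverse.map fun a => (a, c)
  | .strang c => strangFactors c l

/-- Rescale the time fraction of a block. -/
def Block.scale (u : ℝ) : Block → Block
  | .lie c => .lie (u * c)
  | .lieRev c => .lieRev (u * c)
  | .strang c => .strang (u * c)

/-- A Suzuki–Trotter formula: a finite sequence of blocks, in order of application. -/
abbrev Formula : Type := List Block

/-- Rescale the time of a formula. -/
def Formula.scale (u : ℝ) (F : Formula) : Formula := List.map (Block.scale u) F

/-- All the exponentials of a formula, in order of application. -/
def Formula.factors {α : Type*} (F : Formula) (l : List α) : List (α × ℝ) :=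
  List.flatMap (Block.factors l) F

/-- The number of exponentials of the formula, counted for a Hamiltonian split into two parts. -/
def Formula.numExp (F : Formula) : ℕ := (F.factors [(), ()]).length

/-- Product of operators that are listed in order of application (the first acts first). -/
def applyInOrder {n : Type*} [Fintype n] [DecidableEq n] (l : List (Matrix n n ℂ)) :
    Matrix n n ℂ :=
  l.reverse.prod

/-- `S(s)`: the product of the exponentials `e^{-i s c G}` over the factors `(G, c)`. -/
def Formula.step {n : Type*} [Fintype n] [DecidableEq n] (F : Formula)
    (G : List (Matrix n n ℂ)) (s : ℝ) : Matrix n n ℂ :=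
  applyInOrder ((F.factors G).map fun f =>
    NormedSpace.exp ((-(Complex.I * (s * f.2 : ℝ))) • f.1))

/-- The formula has order `p`: `S(s) = e^{-i s ∑ G} + O(s^{p+1})` as `s → 0`, for every finite
list of Hermitian matrices `G`. -/
def Formula.HasOrder (F : Formula) (p : ℕ) : Prop :=
  ∀ (d : ℕ) (G : List (Matrix (Fin d) (Fin d) ℂ)), (∀ A ∈ G, A.IsHermitian) →
    (fun s : ℝ => F.step G s - NormedSpace.exp ((-(Complex.I * (s : ℂ))) • G.sum))
      =O[nhds 0] fun s : ℝ => s ^ (p + 1)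

/-- The first-order Lie–Trotter formula. -/
def lieTrotter : Formula := [Block.lie 1]

/-- The standard recursive Suzuki formula, `suzuki k` being `S_{2k+2}`: `S_2` is the symmetric
formula and `S_{2k+2}(s) = S_{2k}(u s)^2 S_{2k}((1 - 4u) s) S_{2k}(u s)^2` with
`u = 1 / (4 - 4^{1/(2k+1)})` for `k ≥ 1`. -/
def suzuki : ℕ → Formula
  | 0 => [Block.strang 1]
  | k + 1 =>
    let u : ℝ := 1 / (4 - (4 : ℝ) ^ (1 / (2 * (k + 1 : ℕ) + 1 : ℝ)))
    let S := suzuki k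
    Formula.scale u S ++ Formula.scale u S ++ Formula.scale (1 - 4 * u) S ++
      Formula.scale u S ++ Formula.scale u S

/-! ### Circuits -/

/-- The operator that applies the `2 × 2` matrix `U` to qubit `q`. -/
def onQubit {m : ℕ} (q : Fin m) (U : Matrix (Fin 2) (Fin 2) ℂ) : Matrix (Bits m) (Bits m) ℂ :=
  Matrix.of fun x y => if ∀ r, r ≠ q → x r = y r then U (x q) (y q) else 0

/-- The CNOT with control `c` and target `t`: `|y⟩ ↦ |y'⟩` with `y'_t = y_t + y_c (mod 2)`. -/
def cnotMatrix {m : ℕ} (c t : Fin m) : Matrix (Bits m) (Bits m) ℂ :=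
  Matrix.of fun x y => if x = Function.update y t (y t + y c) then 1 else 0

/-- Elementary gates on one oscillator and `m` qubits. -/
inductive Gate (m : ℕ)
  /-- an arbitrary single-qubit unitary on qubit `q` -/
  | single (q : Fin m) (U : Matrix.unitaryGroup (Fin 2) ℂ)
  /-- a CNOT -/
  | cnot (c t : Fin m) (h : c ≠ t)
  /-- the qubit-controlled displacement `e^{-i θ x̂ ⊗ Z_q}` -/
  | condDisp (q : Fin m) (θ : ℝ)
  /-- the unconditional displacement `e^{-i θ x̂}` -/
  | disp (θ : ℝ)
  /-- the global phase `e^{-i θ}` -/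
  | phase (θ : ℝ)

/-- The operator of a gate at Fock cutoff `N`. -/
def Gate.toMatrix (N : ℕ) {m : ℕ} : Gate m → HybridOp N m
  | .single q U => (1 : Matrix (Fin N) (Fin N) ℂ) ⊗ₖ onQubit q (U : Matrix (Fin 2) (Fin 2) ℂ)
  | .cnot c t _ => (1 : Matrix (Fin N) (Fin N) ℂ) ⊗ₖ cnotMatrix c t
  | .condDisp q θ => NormedSpace.exp
      ((-(Complex.I * (θ : ℂ))) • (positionTrunc N ⊗ₖ onQubit q Pauli.Z.toMatrix))
  | .disp θ => NormedSpace.exp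
      ((-(Complex.I * (θ : ℂ))) • (positionTrunc N ⊗ₖ (1 : Matrix (Bits m) (Bits m) ℂ)))
  | .phase θ => Complex.exp (-(Complex.I * (θ : ℂ))) • (1 : HybridOp N m)

/-- Is the gate a CNOT? -/
def Gate.isCnot {m : ℕ} : Gate m → Bool
  | .cnot _ _ _ => true
  | _ => false

/-- Is the gate a hybrid gate, i.e. does it couple to the oscillator? Unconditional displacements
(which implement the identity Pauli string) are counted too. -/
def Gate.isHybrid {m : ℕ} : Gate m → Bool
  | .condDisp _ _ => true
  | .disp _ => true
  | _ => false

/-- A circuit: a list of gates in order of application. -/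
abbrev Circuit (m : ℕ) : Type := List (Gate m)

/-- The operator of a circuit at Fock cutoff `N`. -/
def Circuit.toMatrix (N : ℕ) {m : ℕ} (c : Circuit m) : HybridOp N m :=
  applyInOrder (List.map (Gate.toMatrix N) c)

/-- `N_CNOT`: the number of CNOT gates of a circuit. -/
def Circuit.numCnot {m : ℕ} (c : Circuit m) : ℕ := List.countP Gate.isCnot c

/-- `N_hyb`: the number of hybrid gates of a circuit. -/
def Circuit.numHybrid {m : ℕ} (c : Circuit m) : ℕ := List.countP Gate.isHybrid c

end Hybrid

end

/-!
Three independent arguments prove the theorem.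

*Trotter error.* Let `S(s)` be the product of exponentials of a formula of order `p`. It solves
`S' = 𝓛 S`, where the generator `𝓛(s)` is a sum of summands conjugated by partial products
(`hasDerivAt_factorProd`). Taylor expand each conjugated summand to order `p`, the innermost
exponential first: the exponentials further out are unitary, so they act isometrically on the
remainders, and `𝓛` is a polynomial in `s` of degree `< p` plus a remainder bounded by `s ^ p` times
a sum of `p`-fold nested commutators (`hasTaylor_conj`, `hasTaylor_generator`). The order condition
makes `𝓛(s) + iH` of size `O(s ^ p)`, which forces its polynomial part to vanish, so the remainder
bound holds for `𝓛(s) + iH` itself and Duhamel's principle gives the error of one step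
(`norm_factorExp_sub_factorProd_le`). Each block of the formula runs each summand for the time
fraction of the block, so passing from words in the factors to words in the summands costs only a
power of the total time fraction (`sum_adSum_factors`): the constant does not depend on the number
of summands. Errors of unitary steps add up. For the hybrid Hamiltonian, a nested commutator with
`a` letters `A_i` is `x̂ ^ a` tensored with a nested commutator of qubit operators
(`sum_norm_nestedCommutator_le_commutatorBound`).

*Circuits.* A Pauli string `P` of positive weight `w` is conjugate to `Z` on one of its qubits, by
`w - 1` CNOTs that gather the parity of the support and single-qubit basis changes
(`exists_conjugates_of_weight_ne_zero`). Conjugating one hybrid gate, or one single-qubit rotation,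
implements an exponential of the formula with `2 (w - 1)` CNOTs.

*Order of the standard formulas.* A formula whose time fractions sum to `1` has order `1`. Suzuki's
composition multiplies the leading error term by `4 u ^ (p + 1) + (1 - 4 u) ^ (p + 1) = 0`, and
`S(s) S(-s) = 1` excludes a leading error term of even order, so each step of the recursion gains
two orders (`Formula.HasOrder.suzukiStep`, `Formula.HasOrder.succ_of_isSymmetric`).
-/

noncomputable section

namespace Hybrid

open Complex Asymptotics Filter Topology

/-! ### Taylor remainders on the half-line -/

section Taylor

variable {E : Type*} [NormedAddCommGroup E] [NormedSpace ℝ E]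

/-- `f` agrees on `[0, ∞)` with a polynomial of degree `< p` up to an error of norm at most
`K s ^ p`. The polynomial is left unspecified: only the size of the error is tracked. -/
def HasTaylor (p : ℕ) (f : ℝ → E) (K : ℝ) : Prop :=
  ∃ P : ℕ → E, ∀ s : ℝ, 0 ≤ s → ‖f s - ∑ j ∈ Finset.range p, s ^ j • P j‖ ≤ K * s ^ p

theorem HasTaylor.add {p : ℕ} {f g : ℝ → E} {K K' : ℝ} (hf : HasTaylor p f K)
    (hg : HasTaylor p g K') : HasTaylor p (fun s => f s + g s) (K + K') := by
  obtain ⟨P, hP⟩ := hf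
  obtain ⟨Q, hQ⟩ := hg
  refine ⟨fun j => P j + Q j, fun s hs => ?_⟩
  have : f s + g s - ∑ j ∈ Finset.range p, s ^ j • (P j + Q j) =
      (f s - ∑ j ∈ Finset.range p, s ^ j • P j) + (g s - ∑ j ∈ Finset.range p, s ^ j • Q j) := by
    simp only [smul_add, Finset.sum_add_distrib]
    abel
  rw [this, add_mul]
  exact (norm_add_le _ _).trans (add_le_add (hP s hs) (hQ s hs))

theorem HasTaylor.mono {p : ℕ} {f : ℝ → E} {K K' : ℝ} (hf : HasTaylor p f K) (h : K ≤ K') :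
    HasTaylor p f K' := by
  obtain ⟨P, hP⟩ := hf
  exact ⟨P, fun s hs => (hP s hs).trans (by gcongr)⟩

theorem HasTaylor.congr {p : ℕ} {f g : ℝ → E} {K : ℝ} (hf : HasTaylor p f K)
    (h : ∀ s, f s = g s) : HasTaylor p g K := funext h ▸ hf

theorem HasTaylor.const_zero (p : ℕ) : HasTaylor p (fun _ => (0 : E)) 0 :=
  ⟨fun _ => 0, fun s _ => by simp⟩

theorem HasTaylor.const {p : ℕ} (hp : 1 ≤ p) (x : E) : HasTaylor p (fun _ => x) 0 := by
  obtain ⟨p, rfl⟩ := Nat.exists_eq_add_of_le' hp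
  refine ⟨fun j => if j = 0 then x else 0, fun s _ => ?_⟩
  rw [Finset.sum_eq_single_of_mem 0 (by simp) (fun j _ hj => by simp [hj])]
  simp

theorem HasTaylor.smul {𝕜 : Type*} [NormedField 𝕜] [NormedSpace 𝕜 E] [SMulCommClass ℝ 𝕜 E]
    {p : ℕ} {f : ℝ → E} {K : ℝ} (hf : HasTaylor p f K) (a : 𝕜) :
    HasTaylor p (fun s => a • f s) (‖a‖ * K) := by
  obtain ⟨P, hP⟩ := hf
  refine ⟨fun j => a • P j, fun s hs => ?_⟩
  have : a • f s - ∑ j ∈ Finset.range p, s ^ j • a • P j =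
      a • (f s - ∑ j ∈ Finset.range p, s ^ j • P j) := by
    rw [smul_sub, Finset.smul_sum]
    congr 1
    exact Finset.sum_congr rfl fun j _ => smul_comm _ _ _
  rw [this, norm_smul, mul_assoc]
  exact mul_le_mul_of_nonneg_left (hP s hs) (norm_nonneg _)

theorem HasTaylor.shift {p : ℕ} {f : ℝ → E} {K : ℝ} (hf : HasTaylor p f K) :
    HasTaylor (p + 1) (fun s => s • f s) K := by
  obtain ⟨P, hP⟩ := hf
  refine ⟨fun j => Nat.casesOn j 0 P, fun s hs => ?_⟩
  have : s • f s - ∑ j ∈ Finset.range (p + 1), s ^ j • (Nat.casesOn j 0 P : E) =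
      s • (f s - ∑ j ∈ Finset.range p, s ^ j • P j) := by
    rw [Finset.sum_range_succ', smul_sub, Finset.smul_sum]
    simp [pow_succ', mul_smul]
  rw [this, norm_smul, Real.norm_of_nonneg hs]
  calc s * ‖f s - ∑ j ∈ Finset.range p, s ^ j • P j‖ ≤ s * (K * s ^ p) := by
        gcongr; exact hP s hs
    _ = K * s ^ (p + 1) := by ring

theorem HasTaylor.shift_pow {p : ℕ} {f : ℝ → E} {K : ℝ} (hf : HasTaylor p f K) (j : ℕ) :
    HasTaylor (p + j) (fun s => s ^ j • f s) K := by
  induction j with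
  | zero => simpa using hf
  | succ j ih => exact ih.shift.congr fun s => by rw [smul_smul, pow_succ']

theorem HasTaylor.sum {ι : Type*} (t : Finset ι) {p : ℕ} {f : ι → ℝ → E} {K : ι → ℝ}
    (hf : ∀ i ∈ t, HasTaylor p (f i) (K i)) :
    HasTaylor p (fun s => ∑ i ∈ t, f i s) (∑ i ∈ t, K i) := by
  classical
  induction t using Finset.induction_on with
  | empty => simpa using HasTaylor.const_zero p
  | insert i t hi ih =>
    simp only [Finset.sum_insert hi]
    exact (hf i (by simp)).add (ih fun j hj => hf j (by simp [hj]))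

/-- A polynomial of degree `< p` that is `O(s ^ p)` as `s → 0⁺` vanishes. -/
theorem eq_zero_of_sum_isBigO (p : ℕ) (P : ℕ → E)
    (h : (fun s : ℝ => ∑ j ∈ Finset.range p, s ^ j • P j) =O[𝓝[>] 0] fun s => s ^ p) :
    ∀ j < p, P j = 0 := by
  induction p generalizing P with
  | zero => simp
  | succ p ih =>
    have hpos : ∀ᶠ s : ℝ in 𝓝[>] 0, 0 < s := eventually_mem_nhdsWithin
    have h0 : P 0 = 0 := by
      have hc : Tendsto (fun s : ℝ => ∑ j ∈ Finset.range (p + 1), s ^ j • P j) (𝓝[>] 0)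
          (𝓝 (∑ j ∈ Finset.range (p + 1), (0 : ℝ) ^ j • P j)) := by
        refine Tendsto.mono_left (Continuous.tendsto ?_ 0) nhdsWithin_le_nhds
        fun_prop
      have hz : Tendsto (fun s : ℝ => ∑ j ∈ Finset.range (p + 1), s ^ j • P j) (𝓝[>] 0)
          (𝓝 0) := by
        refine h.trans_tendsto (Tendsto.mono_left ?_ nhdsWithin_le_nhds)
        exact (continuous_pow (p + 1)).tendsto' 0 0 (by simp)
      have := tendsto_nhds_unique hc hz
      rw [Finset.sum_range_succ'] at this
      simpa using this
    have h1 : (fun s : ℝ => ∑ j ∈ Finset.range p, s ^ j • P (j + 1)) =O[𝓝[>] 0]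
        fun s => s ^ p := by
      obtain ⟨c, hc⟩ := h.bound
      refine IsBigO.of_bound c ?_
      filter_upwards [hc, hpos] with s hs hs0
      rw [Finset.sum_range_succ', h0, smul_zero, add_zero] at hs
      have : ∑ j ∈ Finset.range p, s ^ (j + 1) • P (j + 1) =
          s • ∑ j ∈ Finset.range p, s ^ j • P (j + 1) := by
        rw [Finset.smul_sum]
        simp only [pow_succ', mul_smul]
      rw [this, norm_smul, pow_succ', norm_mul, mul_left_comm] at hs
      exact le_of_mul_le_mul_left hs (norm_pos_iff.2 hs0.ne')
    rintro (_ | j) hj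
    · exact h0
    · exact ih _ h1 j (by lia)

/-- If `f = O(s ^ p)`, the Taylor polynomial vanishes and only the remainder is left. -/
theorem HasTaylor.norm_le {p : ℕ} {f : ℝ → E} {K : ℝ} (hf : HasTaylor p f K)
    (h : f =O[𝓝[>] 0] fun s => s ^ p) {s : ℝ} (hs : 0 ≤ s) : ‖f s‖ ≤ K * s ^ p := by
  obtain ⟨P, hP⟩ := hf
  have hO : (fun s : ℝ => ∑ j ∈ Finset.range p, s ^ j • P j) =O[𝓝[>] 0] fun s => s ^ p := by
    have h2 : (fun s => f s - ∑ j ∈ Finset.range p, s ^ j • P j) =O[𝓝[>] 0] fun s => s ^ p := by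
      refine IsBigO.of_bound K ?_
      filter_upwards [self_mem_nhdsWithin] with s (hs : 0 < s)
      simpa [abs_of_pos hs] using hP s hs.le
    simpa using h.sub h2
  have hz := eq_zero_of_sum_isBigO p P hO
  have := hP s hs
  rwa [Finset.sum_eq_zero fun j hj => by rw [hz j (Finset.mem_range.1 hj), smul_zero],
    sub_zero] at this

end Taylor

/-! ### Analytic functions that vanish to a given order -/

section Analytic

variable {E : Type*} [NormedAddCommGroup E] [NormedSpace ℝ E]

theorem exists_eq_pow_smul_of_isBigO {f : ℝ → E} (hf : AnalyticAt ℝ f 0) {n : ℕ}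
    (h : f =O[𝓝 0] fun s => s ^ n) :
    ∃ g : ℝ → E, AnalyticAt ℝ g 0 ∧ ∀ᶠ s in 𝓝 0, f s = s ^ n • g s := by
  suffices hle : (n : ℕ∞) ≤ analyticOrderAt f 0 by
    simpa using (natCast_le_analyticOrderAt hf).1 hle
  by_contra! hlt
  obtain ⟨q, hq⟩ := ENat.ne_top_iff_exists.1 hlt.ne_top
  obtain ⟨g, hg, hg0, hfg⟩ := hf.analyticOrderAt_eq_natCast.1 hq.symm
  simp only [sub_zero] at hfg
  have hqn : q < n := by rw [← hq] at hlt; exact_mod_cast hlt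
  -- dividing by `s ^ q` shows that `g` tends to `0`, although `g 0 ≠ 0`
  have hgO : g =O[𝓝[≠] 0] fun s => s ^ (n - q) := by
    obtain ⟨c, hc⟩ := h.bound
    refine IsBigO.of_bound c ?_
    filter_upwards [nhdsWithin_le_nhds hc, nhdsWithin_le_nhds hfg, self_mem_nhdsWithin]
      with s h1 h2 (h3 : s ≠ 0)
    rw [h2, norm_smul, ← Nat.add_sub_cancel' hqn.le, pow_add, norm_mul, mul_left_comm] at h1
    have := le_of_mul_le_mul_left h1 (norm_pos_iff.2 (pow_ne_zero _ h3))
    simpa using this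
  have hlim : Tendsto g (𝓝[≠] 0) (𝓝 0) := by
    refine hgO.trans_tendsto (Tendsto.mono_left ?_ nhdsWithin_le_nhds)
    exact (continuous_pow (n - q)).tendsto' 0 0 (by simp; lia)
  exact hg0 (tendsto_nhds_unique (hg.continuousAt.tendsto.mono_left nhdsWithin_le_nhds) hlim)

theorem isBigO_deriv_of_isBigO [CompleteSpace E] {f f' : ℝ → E} (hf : AnalyticAt ℝ f 0)
    (hd : ∀ s, HasDerivAt f (f' s) s) {n : ℕ} (h : f =O[𝓝 0] fun s => s ^ (n + 1)) :
    f' =O[𝓝 0] fun s => s ^ n := by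
  obtain ⟨g, hg, hfg⟩ := exists_eq_pow_smul_of_isBigO hf h
  have hev : ∀ᶠ s in 𝓝 0, f' s = s ^ n • ((n + 1 : ℝ) • g s + s • deriv g s) := by
    filter_upwards [hfg.eventually_nhds, hg.eventually_analyticAt] with s h1 h2
    have h3 := ((hasDerivAt_pow (n + 1) s).smul
      h2.differentiableAt.hasDerivAt).congr_of_eventuallyEq h1
    rw [(hd s).unique h3]
    simp only [smul_add, smul_smul, Nat.add_sub_cancel]
    push_cast
    rw [add_comm, mul_comm (s ^ n), ← pow_succ]
  have hb : (fun s => (n + 1 : ℝ) • g s + s • deriv g s) =O[𝓝 0] fun _ => (1 : ℝ) := by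
    have hc : ContinuousAt (fun s => (n + 1 : ℝ) • g s + s • deriv g s) 0 :=
      (hg.continuousAt.const_smul _).add (continuousAt_id.smul hg.deriv.continuousAt)
    exact hc.tendsto.isBigO_one ℝ
  refine ((isBigO_refl (fun s : ℝ => s ^ n) (𝓝 0)).smul hb).congr' ?_ ?_
  · filter_upwards [hev] with s hs using hs.symm
  · exact Eventually.of_forall fun s => by simp

end Analytic

/-! ### Products of exponentials in a C⋆-algebra -/

section Trotter

variable {A : Type*} [CStarAlgebra A]

/-- The exponential `e^{-i s c G}` of a factor `(G, c)`. -/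
def factorExp (f : A × ℝ) (s : ℝ) : A :=
  NormedSpace.exp ((-(I * (s * f.2 : ℝ))) • f.1)

/-- The product of the exponentials of a list of factors, the head of the list acting first. -/
def factorProd : List (A × ℝ) → ℝ → A
  | [], _ => 1
  | f :: l, s => factorProd l s * factorExp f s

theorem factorExp_eq (f : A × ℝ) (s : ℝ) :
    factorExp f s = NormedSpace.exp (s • ((-(I * (f.2 : ℂ))) • f.1)) := by
  rw [factorExp, ← Complex.coe_smul, smul_smul]
  congr 2
  push_cast
  ring

theorem factorExp_zero (f : A × ℝ) : factorExp f 0 = 1 := by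
  rw [factorExp_eq, zero_smul, NormedSpace.exp_zero]

theorem factorExp_mul_neg (f : A × ℝ) (s : ℝ) : factorExp f s * factorExp f (-s) = 1 := by
  let : NormedAlgebra ℚ A := NormedAlgebra.restrictScalars ℚ ℂ A
  rw [factorExp_eq, factorExp_eq, neg_smul s, ← NormedSpace.exp_add_of_commute, add_neg_cancel,
    NormedSpace.exp_zero]
  exact (Commute.refl _).neg_right

theorem factorExp_mem_unitary {f : A × ℝ} (hf : IsSelfAdjoint f.1) (s : ℝ) :
    factorExp f s ∈ unitary A := by
  let : NormedAlgebra ℚ A := NormedAlgebra.restrictScalars ℚ ℂ A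
  refine NormedSpace.exp_mem_unitary_of_mem_skewAdjoint (skewAdjoint.mem_iff.2 ?_)
  rw [star_smul, hf.star_eq, ← neg_smul]
  congr 1
  simp

theorem analyticAt_factorExp (f : A × ℝ) (s : ℝ) : AnalyticAt ℝ (factorExp f) s := by
  have : factorExp f = NormedSpace.exp ∘ fun s : ℝ => s • ((-(I * (f.2 : ℂ))) • f.1) :=
    funext (factorExp_eq f)
  rw [this]
  exact (NormedSpace.exp_analytic (𝕂 := ℝ) _).comp (analyticAt_id.smul analyticAt_const)

theorem hasDerivAt_factorExp (f : A × ℝ) (s : ℝ) :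
    HasDerivAt (factorExp f) ((-(I * (f.2 : ℂ))) • f.1 * factorExp f s) s := by
  have h := hasDerivAt_exp_smul_const' (𝕂 := ℝ) ((-(I * (f.2 : ℂ))) • f.1) s
  rw [← factorExp_eq] at h
  exact h.congr_of_eventuallyEq (Eventually.of_forall fun s => factorExp_eq f s)

theorem commute_factorExp (f : A × ℝ) (s : ℝ) : Commute f.1 (factorExp f s) :=
  let : NormedAlgebra ℚ A := NormedAlgebra.restrictScalars ℚ ℂ A
  ((Commute.refl f.1).smul_right _).exp_right

@[simp] theorem factorProd_nil (s : ℝ) : factorProd ([] : List (A × ℝ)) s = 1 := rfl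

theorem factorProd_cons (f : A × ℝ) (l : List (A × ℝ)) (s : ℝ) :
    factorProd (f :: l) s = factorProd l s * factorExp f s := rfl

theorem factorProd_append (l l' : List (A × ℝ)) (s : ℝ) :
    factorProd (l ++ l') s = factorProd l' s * factorProd l s := by
  induction l with
  | nil => simp
  | cons f l ih => simp [factorProd_cons, ih, mul_assoc]

theorem factorProd_zero (l : List (A × ℝ)) : factorProd l 0 = 1 := by
  induction l with
  | nil => rfl
  | cons f l ih => rw [factorProd_cons, ih, factorExp_zero, one_mul]

theorem factorProd_mul_reverse_neg (l : List (A × ℝ)) (s : ℝ) :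
    factorProd l s * factorProd l.reverse (-s) = 1 := by
  induction l with
  | nil => simp
  | cons f l ih =>
    rw [List.reverse_cons, factorProd_append, factorProd_cons, factorProd_cons, factorProd_nil,
      one_mul, mul_assoc, ← mul_assoc (factorExp f s), factorExp_mul_neg, one_mul, ih]

theorem factorProd_mem_unitary {l : List (A × ℝ)} (hl : ∀ f ∈ l, IsSelfAdjoint f.1) (s : ℝ) :
    factorProd l s ∈ unitary A := by
  induction l with
  | nil => exact one_mem _
  | cons f l ih =>
    simp only [List.mem_cons, forall_eq_or_imp] at hl
    exact mul_mem (ih hl.2) (factorExp_mem_unitary hl.1 s)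

theorem analyticAt_factorProd (l : List (A × ℝ)) (s : ℝ) : AnalyticAt ℝ (factorProd l) s := by
  induction l with
  | nil => exact analyticAt_const
  | cons f l ih => exact ih.mul (analyticAt_factorExp f s)

/-- The time-dependent generator `𝓛` of a product of exponentials `S`, for which `S' = 𝓛 S` when
all the summands are self-adjoint. -/
def generator : List (A × ℝ) → ℝ → A
  | [], _ => 0
  | f :: l, s =>
    generator l s + factorProd l s * ((-(I * (f.2 : ℂ))) • f.1) * star (factorProd l s)

theorem hasDerivAt_factorProd {l : List (A × ℝ)} (hl : ∀ f ∈ l, IsSelfAdjoint f.1) (s : ℝ) :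
    HasDerivAt (factorProd l) (generator l s * factorProd l s) s := by
  induction l with
  | nil => exact (hasDerivAt_const s (1 : A)).congr_deriv (by simp [generator])
  | cons f l ih =>
    simp only [List.mem_cons, forall_eq_or_imp] at hl
    have hu := Unitary.star_mul_self_of_mem (factorProd_mem_unitary hl.2 s)
    refine ((ih hl.2).mul (hasDerivAt_factorExp f s)).congr_deriv ?_
    rw [generator, factorProd_cons, add_mul]
    congr 1
    · exact mul_assoc (generator l s) (factorProd l s) (factorExp f s)
    · rw [mul_assoc (_ * _) (star _), ← mul_assoc (star _), hu, one_mul, mul_assoc]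

theorem generator_zero (l : List (A × ℝ)) :
    generator l 0 = (l.map fun f => (-(I * (f.2 : ℂ))) • f.1).sum := by
  induction l with
  | nil => rfl
  | cons f l ih =>
    rw [generator, ih, factorProd_zero, star_one, one_mul, mul_one, List.map_cons, List.sum_cons,
      add_comm]

/-! ### Commutator bounds for conjugated operators -/

theorem norm_conj_of_mem_unitary {U : A} (hU : U ∈ unitary A) (X : A) :
    ‖U * X * star U‖ = ‖X‖ := by
  rw [CStarRing.norm_mul_mem_unitary _ (Unitary.star_mem hU), CStarRing.norm_mem_unitary_mul _ hU]

/-- `ad_G^j X = [G, [G, ⋯ [G, X] ⋯ ]]`. -/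
def adPow (G : A) : ℕ → A → A
  | 0, X => X
  | j + 1, X => adPow G j ⁅G, X⁆

theorem hasDerivAt_conj_factorExp {f : A × ℝ} (hf : IsSelfAdjoint f.1) (X : A) (s : ℝ) :
    HasDerivAt (fun s => factorExp f s * X * star (factorExp f s))
      ((-(I * (f.2 : ℂ))) • (factorExp f s * ⁅f.1, X⁆ * star (factorExp f s))) s := by
  have h := hasDerivAt_factorExp f s
  refine ((h.mul_const X).mul h.star).congr_deriv ?_
  have hc := (commute_factorExp f s).eq
  have hcs : star (factorExp f s) * f.1 = f.1 * star (factorExp f s) := by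
    have := congrArg star hc
    rwa [star_mul, star_mul, hf.star_eq] at this
  simp only [star_mul, star_smul, hf.star_eq, smul_mul_assoc, mul_smul_comm, Ring.lie_def]
  rw [hc, hcs]
  simp only [star_neg, star_def, map_mul, conj_I, conj_ofReal, neg_mul, neg_neg, mul_sub, sub_mul,
    smul_sub, neg_smul, mul_assoc, sub_neg_eq_add]

/-- One conjugated exponential: the Taylor remainder of `e^{-i s c G} X e^{i s c G}` at order `p`
is controlled by the `p`-fold commutator. -/
theorem norm_conj_factorExp_sub_le {f : A × ℝ} (hf : IsSelfAdjoint f.1) (p : ℕ) (X : A) {s : ℝ}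
    (hs : 0 ≤ s) :
    ‖factorExp f s * X * star (factorExp f s) -
        ∑ j ∈ Finset.range p, s ^ j • (((-(I * (f.2 : ℂ))) ^ j / (j.factorial : ℂ)) •
          adPow f.1 j X)‖ ≤ |f.2| ^ p * ‖adPow f.1 p X‖ * s ^ p := by
  induction p generalizing X s with
  | zero =>
    simpa [adPow] using (norm_conj_of_mem_unitary (factorExp_mem_unitary hf s) X).le
  | succ p ih =>
    set a : ℂ := -(I * (f.2 : ℂ)) with ha
    have hna : ‖a‖ = |f.2| := by simp [ha]
    set h : ℝ → A := fun s => factorExp f s * X * star (factorExp f s) -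
      ∑ j ∈ Finset.range (p + 1), s ^ j • ((a ^ j / (j.factorial : ℂ)) • adPow f.1 j X) with hh
    have hd : ∀ s, HasDerivAt h (a • (factorExp f s * ⁅f.1, X⁆ * star (factorExp f s) -
        ∑ j ∈ Finset.range p, s ^ j • ((a ^ j / (j.factorial : ℂ)) • adPow f.1 j ⁅f.1, X⁆))) s := by
      intro s
      rw [smul_sub]
      refine (hasDerivAt_conj_factorExp hf X s).sub ?_
      have hs : HasDerivAt (fun s : ℝ => ∑ j ∈ Finset.range (p + 1),
          s ^ j • ((a ^ j / (j.factorial : ℂ)) • adPow f.1 j X))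
          (∑ j ∈ Finset.range (p + 1), ((j : ℝ) * s ^ (j - 1)) •
            ((a ^ j / (j.factorial : ℂ)) • adPow f.1 j X)) s :=
        HasDerivAt.fun_sum fun j _ => (hasDerivAt_pow j s).smul_const _
      refine hs.congr_deriv ?_
      rw [Finset.sum_range_succ', Finset.smul_sum]
      simp only [Nat.cast_zero, zero_mul, zero_smul, add_zero]
      refine Finset.sum_congr rfl fun j _ => ?_
      rw [smul_comm a, smul_smul a, mul_comm _ (s ^ _), mul_smul, Nat.add_sub_cancel,
        ← Complex.coe_smul ((j + 1 : ℕ) : ℝ), smul_smul, adPow]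
      congr 2
      have h1 : ((j.factorial : ℕ) : ℂ) ≠ 0 := by exact_mod_cast j.factorial_ne_zero
      have h2 : ((j : ℂ) + 1) ≠ 0 := by exact_mod_cast j.succ_ne_zero
      rw [Nat.factorial_succ]
      push_cast
      field_simp
      exact pow_succ' a j
    have h0 : h 0 = 0 := by
      rw [hh]
      simp only
      rw [Finset.sum_range_succ', factorExp_zero]
      simp [adPow]
    have hb : ∀ x ∈ Set.Ico 0 s, ‖a • (factorExp f x * ⁅f.1, X⁆ * star (factorExp f x) -
        ∑ j ∈ Finset.range p, x ^ j • ((a ^ j / (j.factorial : ℂ)) • adPow f.1 j ⁅f.1, X⁆))‖ ≤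
        |f.2| ^ (p + 1) * ‖adPow f.1 (p + 1) X‖ * s ^ p := by
      intro x hx
      rw [norm_smul, hna, pow_succ', mul_assoc |f.2|, mul_assoc |f.2|]
      refine mul_le_mul_of_nonneg_left ?_ (abs_nonneg _)
      refine (ih ⁅f.1, X⁆ hx.1).trans ?_
      rw [adPow]
      exact mul_le_mul_of_nonneg_left (pow_le_pow_left₀ hx.1 hx.2.le _) (by positivity)
    have := norm_image_sub_le_of_norm_deriv_le_segment' (f := h) (a := 0) (b := s)
      (fun x _ => (hd x).hasDerivWithinAt) hb s ⟨hs, le_rfl⟩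
    rw [h0, sub_zero, sub_zero] at this
    exact this.trans_eq (by ring)

/-- The weighted sum of `∏ |c_k| ‖[G_{k_p}, [ ⋯ [G_{k_1}, X] ⋯ ]]‖` over all words of length `p` in
the factors `(G_k, c_k)` of a list. -/
def adSum (l : List (A × ℝ)) : ℕ → A → ℝ
  | 0, X => ‖X‖
  | p + 1, X => (l.map fun f => |f.2| * adSum l p ⁅f.1, X⁆).sum

theorem adSum_nonneg (l : List (A × ℝ)) (p : ℕ) (X : A) : 0 ≤ adSum l p X := by
  induction p generalizing X with
  | zero => exact norm_nonneg X
  | succ p ih =>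
    refine List.sum_nonneg fun x hx => ?_
    obtain ⟨f, -, rfl⟩ := List.mem_map.1 hx
    exact mul_nonneg (abs_nonneg _) (ih _)

theorem adSum_le_adSum_cons (f : A × ℝ) (l : List (A × ℝ)) (p : ℕ) (X : A) :
    adSum l p X ≤ adSum (f :: l) p X := by
  induction p generalizing X with
  | zero => exact le_rfl
  | succ p ih =>
    rw [adSum, adSum, List.map_cons, List.sum_cons]
    have h1 : (l.map fun g => |g.2| * adSum l p ⁅g.1, X⁆).sum ≤
        (l.map fun g => |g.2| * adSum (f :: l) p ⁅g.1, X⁆).sum :=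
      List.sum_le_sum fun g _ => mul_le_mul_of_nonneg_left (ih _) (abs_nonneg _)
    have h2 := mul_nonneg (abs_nonneg f.2) (adSum_nonneg (f :: l) p ⁅f.1, X⁆)
    linarith

/-- Words that use the first factor `j` times innermost and then only the other factors are among
all words. -/
theorem sum_adSum_adPow_le (f : A × ℝ) (l : List (A × ℝ)) (p : ℕ) (X : A) :
    ∑ j ∈ Finset.range (p + 1), |f.2| ^ j * adSum l (p - j) (adPow f.1 j X) ≤
      adSum (f :: l) p X := by
  induction p generalizing X with
  | zero => simp [adSum, adPow]
  | succ p ih =>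
    rw [Finset.sum_range_succ']
    simp only [Nat.add_sub_add_right, pow_zero, one_mul, Nat.sub_zero, adPow]
    have h1 : ∑ j ∈ Finset.range (p + 1), |f.2| ^ (j + 1) *
        adSum l (p - j) (adPow f.1 j ⁅f.1, X⁆) ≤ |f.2| * adSum (f :: l) p ⁅f.1, X⁆ := by
      simp only [pow_succ', mul_assoc, ← Finset.mul_sum]
      exact mul_le_mul_of_nonneg_left (ih _) (abs_nonneg _)
    have h2 : adSum l (p + 1) X ≤ (l.map fun g => |g.2| * adSum (f :: l) p ⁅g.1, X⁆).sum :=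
      List.sum_le_sum fun g _ =>
        mul_le_mul_of_nonneg_left (adSum_le_adSum_cons f l p _) (abs_nonneg _)
    calc _ ≤ _ := add_le_add h1 h2
      _ = adSum (f :: l) (p + 1) X := by rw [adSum, List.map_cons, List.sum_cons]

/-- The Taylor remainder of `S(s) X S(s)⋆` is controlled by `p`-fold commutators: expand the
innermost conjugation first, so that the outer ones, being isometric, never touch a remainder. -/
theorem hasTaylor_conj {l : List (A × ℝ)} (hl : ∀ f ∈ l, IsSelfAdjoint f.1) (p : ℕ) (X : A) :
    HasTaylor p (fun s => factorProd l s * X * star (factorProd l s)) (adSum l p X) := by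
  induction l generalizing p X with
  | nil =>
    rcases p with _ | p
    · exact ⟨0, by simp [adSum]⟩
    · refine ((HasTaylor.const (Nat.succ_pos p) X).congr fun s => ?_).mono ?_
      · simp
      · simp [adSum]
  | cons f l ih =>
    simp only [List.mem_cons, forall_eq_or_imp] at hl
    set a : ℂ := -(I * (f.2 : ℂ)) with ha
    have hna : ‖a‖ = |f.2| := by simp [ha]
    set φ : ℝ → A → A := fun s Y => factorProd l s * Y * star (factorProd l s) with hφ
    set T : ℝ → A := fun s => ∑ j ∈ Finset.range p, s ^ j • ((a ^ j / (j.factorial : ℂ)) •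
      adPow f.1 j X) with hT
    have hmain : HasTaylor p (fun s => φ s (T s))
        (∑ j ∈ Finset.range p, |f.2| ^ j * adSum l (p - j) (adPow f.1 j X)) := by
      have := HasTaylor.sum (Finset.range p) (p := p)
        (f := fun j s => s ^ j • ((a ^ j / (j.factorial : ℂ)) • φ s (adPow f.1 j X)))
        (K := fun j => |f.2| ^ j * adSum l (p - j) (adPow f.1 j X)) ?_
      · refine this.congr fun s => ?_
        simp only [hφ, hT, Finset.mul_sum, Finset.sum_mul, mul_smul_comm, smul_mul_assoc]
      · intro j hj
        have hj' : p - j + j = p := Nat.sub_add_cancel (Finset.mem_range.1 hj).le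
        have h := (((ih hl.2 (p - j) (adPow f.1 j X)).smul (a ^ j / (j.factorial : ℂ))).shift_pow j)
        rw [hj'] at h
        refine h.mono (mul_le_mul_of_nonneg_right ?_ (adSum_nonneg _ _ _))
        rw [norm_div, norm_pow, hna, Complex.norm_natCast]
        exact div_le_self (by positivity) (by exact_mod_cast j.factorial_pos)
    have hrem : HasTaylor p
        (fun s => φ s (factorExp f s * X * star (factorExp f s) - T s))
        (|f.2| ^ p * adSum l (p - p) (adPow f.1 p X)) := by
      refine ⟨0, fun s hs => ?_⟩
      simp only [Pi.zero_apply, smul_zero, Finset.sum_const_zero, sub_zero, Nat.sub_self, adSum]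
      rw [hφ]
      simp only
      rw [norm_conj_of_mem_unitary (factorProd_mem_unitary hl.2 s)]
      exact norm_conj_factorExp_sub_le hl.1 p X hs
    have hsum := hmain.add hrem
    rw [← Finset.sum_range_succ (fun j => |f.2| ^ j * adSum l (p - j) (adPow f.1 j X))] at hsum
    refine (hsum.congr fun s => ?_).mono (sum_adSum_adPow_le f l p X)
    simp only [hφ, factorProd_cons, star_mul, mul_sub, sub_mul, mul_assoc]
    abel

theorem hasTaylor_generator {l : List (A × ℝ)} (hl : ∀ f ∈ l, IsSelfAdjoint f.1) (p : ℕ) :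
    HasTaylor p (generator l) ((l.map fun f => |f.2| * adSum l p f.1).sum) := by
  induction l with
  | nil => simpa [generator] using HasTaylor.const_zero p
  | cons f l ih =>
    have hl' := hl
    simp only [List.mem_cons, forall_eq_or_imp] at hl'
    have h1 := (hasTaylor_conj hl'.2 p f.1).smul (-(I * (f.2 : ℂ)))
    refine (((ih hl'.2).add h1).congr fun s => ?_).mono ?_
    · rw [generator, mul_smul_comm, smul_mul_assoc]
    · rw [List.map_cons, List.sum_cons, add_comm]
      have hn : ‖(-(I * (f.2 : ℂ)))‖ = |f.2| := by simp
      rw [hn]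
      refine add_le_add ?_ ?_
      · exact mul_le_mul_of_nonneg_left (adSum_le_adSum_cons f l p _) (abs_nonneg _)
      · exact List.sum_le_sum fun g _ =>
          mul_le_mul_of_nonneg_left (adSum_le_adSum_cons f l p _) (abs_nonneg _)

/-- **Commutator scaling of the Trotter error.** If a product of exponentials agrees with
`e^{-isH}` to order `p`, its error at time `s ≥ 0` is at most `s ^ (p + 1)` times the weighted sum
of the `p`-fold nested commutators of its factors. -/
theorem norm_factorExp_sub_factorProd_le {l : List (A × ℝ)} (hl : ∀ f ∈ l, IsSelfAdjoint f.1)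
    {H : A} (hH : IsSelfAdjoint H) {p : ℕ} (hp : 1 ≤ p)
    (hO : (fun s => factorProd l s - factorExp (H, 1) s) =O[𝓝 0] fun s : ℝ => s ^ (p + 1))
    {s : ℝ} (hs : 0 ≤ s) :
    ‖factorExp (H, 1) s - factorProd l s‖ ≤
      (l.map fun f => |f.2| * adSum l p f.1).sum * s ^ (p + 1) := by
  set K := (l.map fun f => |f.2| * adSum l p f.1).sum with hK
  have hK0 : 0 ≤ K := by
    refine List.sum_nonneg fun x hx => ?_
    obtain ⟨f, -, rfl⟩ := List.mem_map.1 hx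
    exact mul_nonneg (abs_nonneg _) (adSum_nonneg _ _ _)
  set a : ℂ := -(I * ((1 : ℝ) : ℂ)) with ha
  have hHs : ∀ s, HasDerivAt (factorExp (H, 1)) (a • H * factorExp (H, 1) s) s :=
    fun s => hasDerivAt_factorExp (H, 1) s
  have hSs := hasDerivAt_factorProd hl
  -- the error of the generator is `O(s ^ p)`, hence equal to its Taylor remainder
  have hE : ∀ s : ℝ, 0 ≤ s → ‖generator l s - a • H‖ ≤ K * s ^ p := by
    intro s hs
    have hT : HasTaylor p (fun s => generator l s - a • H) K := by
      have := (hasTaylor_generator hl p).add (HasTaylor.const hp (-(a • H)))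
      rw [add_zero] at this
      exact this.congr fun s => (sub_eq_add_neg _ _).symm
    refine hT.norm_le ?_ hs
    have hD : (fun s => generator l s * factorProd l s - a • H * factorExp (H, 1) s)
        =O[𝓝 0] fun s : ℝ => s ^ p :=
      isBigO_deriv_of_isBigO
        ((analyticAt_factorProd l 0).sub (analyticAt_factorExp (H, 1) 0))
        (fun s => (hSs s).sub (hHs s)) hO
    have hO' : (fun s => a • H * (factorProd l s - factorExp (H, 1) s))
        =O[𝓝 0] fun s : ℝ => s ^ p := by
      have h1 : (fun s => a • H * (factorProd l s - factorExp (H, 1) s))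
          =O[𝓝 0] fun s => factorProd l s - factorExp (H, 1) s :=
        IsBigO.of_bound ‖a • H‖ (Eventually.of_forall fun s => norm_mul_le _ _)
      refine (h1.trans hO).trans (IsBigO.of_bound 1 ?_)
      filter_upwards [Metric.ball_mem_nhds (0 : ℝ) one_pos] with s hs1
      rw [one_mul, norm_pow, norm_pow]
      refine pow_le_pow_of_le_one (norm_nonneg _) ?_ (Nat.le_succ p)
      simpa using (mem_ball_zero_iff.1 hs1).le
    refine IsBigO.mono ?_ nhdsWithin_le_nhds
    refine ((hD.sub hO').norm_left.congr_left fun s => ?_).of_norm_left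
    rw [← CStarRing.norm_mul_mem_unitary (generator l s - a • H) (factorProd_mem_unitary hl s)]
    congr 1
    rw [sub_mul, mul_sub]
    abel
  -- Duhamel: integrate the error of the generator in the interaction picture
  have hU : ∀ s, factorExp (H, 1) s ∈ unitary A := factorExp_mem_unitary (f := (H, 1)) hH
  set w : ℝ → A := fun s => star (factorExp (H, 1) s) * factorProd l s with hw
  have hwd : ∀ s, HasDerivAt w
      (star (factorExp (H, 1) s) * (generator l s - a • H) * factorProd l s) s := by
    intro s
    refine ((hHs s).star.mul (hSs s)).congr_deriv ?_
    have hst : star (a • H) = -(a • H) := by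
      rw [star_smul, hH.star_eq, ← neg_smul]
      congr 1
      simp [ha]
    rw [star_mul, hst]
    simp only [mul_sub, sub_mul, mul_neg, neg_mul, mul_assoc]
    abel
  have hb : ∀ x ∈ Set.Ico 0 s,
      ‖star (factorExp (H, 1) x) * (generator l x - a • H) * factorProd l x‖ ≤ K * s ^ p := by
    intro x hx
    rw [CStarRing.norm_mul_mem_unitary _ (factorProd_mem_unitary hl x),
      CStarRing.norm_mem_unitary_mul _ (Unitary.star_mem (hU x))]
    exact (hE x hx.1).trans
      (mul_le_mul_of_nonneg_left (pow_le_pow_left₀ hx.1 hx.2.le _) hK0)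
  have hfin := norm_image_sub_le_of_norm_deriv_le_segment' (f := w) (a := 0) (b := s)
    (fun x _ => (hwd x).hasDerivWithinAt) hb s ⟨hs, le_rfl⟩
  have hw0 : w 0 = 1 := by simp [hw, factorExp_zero, factorProd_zero]
  rw [hw0, sub_zero, ← CStarRing.norm_mem_unitary_mul _ (hU s), mul_sub, hw] at hfin
  simp only at hfin
  rw [← mul_assoc, Unitary.mul_star_self_of_mem (hU s), one_mul, mul_one, norm_sub_rev] at hfin
  exact hfin.trans_eq (by ring)

end Trotter

/-! ### Factors of a formula -/

section Factors

variable {α β : Type*}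

/-- The time fraction of a block. -/
def Block.frac : Block → ℝ
  | .lie c => c
  | .lieRev c => c
  | .strang c => c

/-- The total of `|c|` over the blocks: the time for which the formula runs each summand,
backward evolution counted positively. -/
def Formula.absTime (F : Formula) : ℝ := (List.map (fun b => |b.frac|) F).sum

theorem Formula.absTime_nonneg (F : Formula) : 0 ≤ F.absTime :=
  List.sum_nonneg fun x hx => by
    obtain ⟨b, -, rfl⟩ := List.mem_map.1 hx
    exact abs_nonneg _

theorem strangFactors_map (φ : α → β) (c : ℝ) (l : List α) :
    strangFactors c (l.map φ) = (strangFactors c l).map (Prod.map φ id) := by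
  fun_induction strangFactors c l with
  | case1 => simp [strangFactors]
  | case2 a => simp [strangFactors]
  | case3 a b l ih => simpa [strangFactors] using ih

theorem Block.factors_map (φ : α → β) (l : List α) (b : Block) :
    b.factors (l.map φ) = (b.factors l).map (Prod.map φ id) := by
  cases b <;> simp [Block.factors, strangFactors_map]

theorem Formula.factors_map (φ : α → β) (F : Formula) (l : List α) :
    F.factors (l.map φ) = (F.factors l).map (Prod.map φ id) := by
  simp only [Formula.factors, List.map_flatMap, ← Block.factors_map]

theorem strangFactors_fst_mem {c : ℝ} {l : List α} {f : α × ℝ} (hf : f ∈ strangFactors c l) :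
    f.1 ∈ l := by
  fun_induction strangFactors c l with
  | case1 => simp at hf
  | case2 a => simp_all
  | case3 a b l ih =>
    simp only [List.mem_cons, List.mem_append, List.not_mem_nil, or_false] at hf ih ⊢
    rcases hf with rfl | h | rfl
    · simp
    · exact Or.inr (ih h)
    · simp

theorem Formula.factors_fst_mem {F : Formula} {l : List α} {f : α × ℝ} (hf : f ∈ F.factors l) :
    f.1 ∈ l := by
  obtain ⟨b, -, hb⟩ := List.mem_flatMap.1 hf
  cases b with
  | lie c => obtain ⟨a, ha, rfl⟩ := List.mem_map.1 hb; exact ha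
  | lieRev c => obtain ⟨a, ha, rfl⟩ := List.mem_map.1 hb; exact List.mem_reverse.1 ha
  | strang c => exact strangFactors_fst_mem hb

theorem sum_strangFactors {M : Type*} [AddCommGroup M] [Module ℝ M] (w : ℝ → ℝ)
    (hw : ∀ c, w (c / 2) + w (c / 2) = w c) (φ : α → M) (c : ℝ) (l : List α) :
    ((strangFactors c l).map fun f => w f.2 • φ f.1).sum = w c • (l.map φ).sum := by
  fun_induction strangFactors c l with
  | case1 => simp
  | case2 a => simp
  | case3 a b l ih =>
    simp only [List.map_cons, List.map_append, List.sum_cons, List.sum_append, List.map_nil,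
      List.sum_nil, add_zero] at ih ⊢
    rw [ih, smul_add _ (φ a), ← hw c]
    module

/-- Every block runs every summand for the time fraction of the block, in one or two pieces. Here
`w` weighs time fractions; it is used for `c ↦ c` and `c ↦ |c|`. -/
theorem Formula.sum_factors {M : Type*} [AddCommGroup M] [Module ℝ M] (w : ℝ → ℝ)
    (hw : ∀ c, w (c / 2) + w (c / 2) = w c) (φ : α → M) (F : Formula) (l : List α) :
    ((F.factors l).map fun f => w f.2 • φ f.1).sum =
      (List.map (fun b => w b.frac) F).sum • (l.map φ).sum := by
  induction F with
  | nil => simp [Formula.factors]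
  | cons b F ih =>
    have hb : ((b.factors l).map fun f => w f.2 • φ f.1).sum = w b.frac • (l.map φ).sum := by
      cases b with
      | lie c => simp [Block.factors, Block.frac, Function.comp_def, List.smul_sum]
      | lieRev c =>
        simp only [Block.factors, Block.frac, List.map_map, Function.comp_def, List.map_reverse,
          List.sum_reverse, List.smul_sum]
      | strang c => exact sum_strangFactors w hw φ c l
    rw [Formula.factors] at ih ⊢
    rw [List.flatMap_cons, List.map_append, List.sum_append, hb, ih, List.map_cons, List.sum_cons,
      add_smul]

theorem Formula.sum_abs_factors (φ : α → ℝ) (F : Formula) (l : List α) :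
    ((F.factors l).map fun f => |f.2| * φ f.1).sum = F.absTime * (l.map φ).sum :=
  F.sum_factors (fun c => |c|) (fun c => by rw [← two_mul, abs_div, abs_two]; ring) φ l

end Factors

section AdSum

variable {A : Type*} [CStarAlgebra A]

theorem adSum_factors (F : Formula) (G : List A) (p : ℕ) (X : A) :
    adSum (F.factors G) p X = F.absTime ^ p * adSum (G.map fun g => (g, (1 : ℝ))) p X := by
  induction p generalizing X with
  | zero => simp [adSum]
  | succ p ih =>
    simp only [adSum, ih, List.map_map, Function.comp_def, abs_one, one_mul]
    rw [F.sum_abs_factors (fun g => F.absTime ^ p * adSum (G.map fun g => (g, (1 : ℝ))) p ⁅g, X⁆),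
      List.sum_map_mul_left]
    ring

theorem sum_adSum_factors (F : Formula) (G : List A) (p : ℕ) :
    ((F.factors G).map fun f => |f.2| * adSum (F.factors G) p f.1).sum =
      F.absTime ^ (p + 1) * (G.map (adSum (G.map fun g => (g, (1 : ℝ))) p)).sum := by
  simp only [adSum_factors]
  rw [F.sum_abs_factors (fun g => F.absTime ^ p * adSum (G.map fun g => (g, (1 : ℝ))) p g),
    List.sum_map_mul_left]
  ring

end AdSum

section Step

variable {n : Type*} [Fintype n] [DecidableEq n]

theorem applyInOrder_nil : applyInOrder ([] : List (Matrix n n ℂ)) = 1 := rfl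

theorem applyInOrder_cons (M : Matrix n n ℂ) (l : List (Matrix n n ℂ)) :
    applyInOrder (M :: l) = applyInOrder l * M := by simp [applyInOrder]

theorem applyInOrder_append (l l' : List (Matrix n n ℂ)) :
    applyInOrder (l ++ l') = applyInOrder l' * applyInOrder l := by simp [applyInOrder]

theorem Formula.step_eq_factorProd (F : Formula) (G : List (Matrix n n ℂ)) (s : ℝ) :
    F.step G s = factorProd (F.factors G) s := by
  rw [Formula.step]
  induction F.factors G with
  | nil => rfl
  | cons f l ih => rw [List.map_cons, applyInOrder_cons, ih, factorProd_cons]; rfl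

/-- The reindexing of matrices along `e`, as a star algebra equivalence. -/
def reindexStar {m : Type*} [Fintype m] [DecidableEq m] (e : n ≃ m) :
    Matrix n n ℂ ≃⋆ₐ[ℂ] Matrix m m ℂ :=
  StarAlgEquiv.ofAlgEquiv (Matrix.reindexAlgEquiv ℂ ℂ e) fun M => by
    ext i j; simp [Matrix.star_apply]

end Step

theorem map_factorProd {A B : Type*} [CStarAlgebra A] [CStarAlgebra B] (φ : A ≃⋆ₐ[ℂ] B)
    (l : List (A × ℝ)) (s : ℝ) :
    φ (factorProd l s) = factorProd (l.map (Prod.map φ id)) s := by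
  let : NormedAlgebra ℚ A := NormedAlgebra.restrictScalars ℚ ℂ A
  let : NormedAlgebra ℚ B := NormedAlgebra.restrictScalars ℚ ℂ B
  induction l with
  | nil => exact map_one φ
  | cons f l ih =>
    rw [factorProd_cons, map_mul, ih, List.map_cons, factorProd_cons, factorExp, factorExp,
      NormedSpace.map_exp φ (StarAlgEquiv.isometry φ).continuous, map_smul]
    rfl

theorem Formula.factors_isSelfAdjoint {A : Type*} [Star A] {F : Formula} {G : List A}
    (hG : ∀ M ∈ G, IsSelfAdjoint M) : ∀ f ∈ F.factors G, IsSelfAdjoint f.1 :=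
  fun _ hf => hG _ (Formula.factors_fst_mem hf)

theorem isSelfAdjoint_list_sum {A : Type*} [AddMonoid A] [StarAddMonoid A] {G : List A}
    (hG : ∀ M ∈ G, IsSelfAdjoint M) : IsSelfAdjoint G.sum := by
  induction G with
  | nil => exact IsSelfAdjoint.zero _
  | cons M G ih =>
    simp only [List.mem_cons, forall_eq_or_imp] at hG
    rw [List.sum_cons]
    exact IsSelfAdjoint.add hG.1 (ih hG.2)

section Error

variable {n : Type*} [Fintype n] [DecidableEq n]

theorem Formula.HasOrder.isBigO {F : Formula} {p : ℕ} (hF : F.HasOrder p)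
    {G : List (Matrix n n ℂ)} (hG : ∀ M ∈ G, M.IsHermitian) :
    (fun s => factorProd (F.factors G) s - factorExp (G.sum, 1) s)
      =O[𝓝 0] fun s : ℝ => s ^ (p + 1) := by
  let e := Fintype.equivFin n
  have h := hF _ (G.map (reindexStar e)) (by
    intro M hM
    obtain ⟨M', hM', rfl⟩ := List.mem_map.1 hM
    exact (Matrix.isHermitian_submatrix_equiv e.symm).2 (hG M' hM'))
  refine (h.norm_left.congr_left fun s => ?_).of_norm_left
  rw [← StarAlgEquiv.norm_map (reindexStar e), map_sub, map_factorProd, ← Formula.factors_map,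
    ← Formula.step_eq_factorProd]
  congr 2
  have := map_factorProd (reindexStar e) [(G.sum, 1)] s
  rw [factorProd_cons, factorProd_nil, one_mul] at this
  rw [this, ← map_list_sum, List.map_singleton, factorProd_cons, factorProd_nil, one_mul,
    factorExp]
  simp

/-- The error of one step of a formula of order `p`. -/
theorem Formula.HasOrder.norm_sub_step_le {F : Formula} {p : ℕ} (hp : 1 ≤ p) (hF : F.HasOrder p)
    {G : List (Matrix n n ℂ)} (hG : ∀ M ∈ G, M.IsHermitian) {s : ℝ} (hs : 0 ≤ s) :
    ‖factorExp (G.sum, 1) s - F.step G s‖ ≤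
      F.absTime ^ (p + 1) * (G.map (adSum (G.map fun g => (g, (1 : ℝ))) p)).sum * s ^ (p + 1) := by
  rw [← sum_adSum_factors, Formula.step_eq_factorProd]
  exact norm_factorExp_sub_factorProd_le (Formula.factors_isSelfAdjoint hG)
    (isSelfAdjoint_list_sum hG) hp (hF.isBigO hG) hs

theorem norm_pow_sub_pow_le_of_mem_unitary {A : Type*} [CStarAlgebra A] {U V : A}
    (hU : U ∈ unitary A) (hV : V ∈ unitary A) (k : ℕ) : ‖U ^ k - V ^ k‖ ≤ k * ‖U - V‖ := by
  induction k with
  | zero => simp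
  | succ k ih =>
    have : U ^ (k + 1) - V ^ (k + 1) = U ^ k * (U - V) + (U ^ k - V ^ k) * V := by
      rw [pow_succ, pow_succ]; noncomm_ring
    rw [this]
    refine (norm_add_le _ _).trans ?_
    rw [CStarRing.norm_mem_unitary_mul _ (pow_mem hU k), CStarRing.norm_mul_mem_unitary _ hV]
    push_cast
    linarith

theorem factorExp_pow_div {A : Type*} [CStarAlgebra A] (f : A × ℝ) (t : ℝ) {k : ℕ} (hk : 1 ≤ k) :
    factorExp f (t / k) ^ k = factorExp f t := by
  let : NormedAlgebra ℚ A := NormedAlgebra.restrictScalars ℚ ℂ A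
  rw [factorExp_eq, factorExp_eq, ← NormedSpace.exp_nsmul, ← Nat.cast_smul_eq_nsmul ℝ, smul_smul]
  congr 2
  field_simp

/-- The error of `k` steps of a formula of order `p`. -/
theorem Formula.HasOrder.norm_sub_step_pow_le {F : Formula} {p : ℕ} (hp : 1 ≤ p)
    (hF : F.HasOrder p) {G : List (Matrix n n ℂ)} (hG : ∀ M ∈ G, M.IsHermitian) {t : ℝ}
    (ht : 0 ≤ t) {k : ℕ} (hk : 1 ≤ k) :
    ‖factorExp (G.sum, 1) t - F.step G (t / k) ^ k‖ ≤
      F.absTime ^ (p + 1) * (G.map (adSum (G.map fun g => (g, (1 : ℝ))) p)).sum *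
        (t ^ (p + 1) / k ^ p) := by
  have hk0 : (0 : ℝ) < k := by exact_mod_cast hk
  have hU := factorExp_mem_unitary (f := (G.sum, 1)) (isSelfAdjoint_list_sum hG) (t / k)
  have hV : F.step G (t / k) ∈ unitary _ := by
    rw [Formula.step_eq_factorProd]
    exact factorProd_mem_unitary (Formula.factors_isSelfAdjoint hG) _
  rw [← factorExp_pow_div _ t hk]
  refine (norm_pow_sub_pow_le_of_mem_unitary hU hV k).trans ?_
  have := hF.norm_sub_step_le hp hG (div_nonneg ht hk0.le)
  refine (mul_le_mul_of_nonneg_left this hk0.le).trans_eq ?_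
  rw [div_pow, pow_succ (k : ℝ)]
  field_simp

end Error

/-! ### Nested commutators of words -/

section Nested

variable {M : Type*} [Ring M]

theorem nestedCommutator_succ_eq (p : ℕ) (R : Fin (p + 2) → M) :
    nestedCommutator (p + 1) R =
      nestedCommutator p (Fin.cons ⁅R 1, R 0⁆ fun k => R k.succ.succ) := by
  induction p with
  | zero => rfl
  | succ p ih =>
    rw [nestedCommutator, ih, nestedCommutator]
    congr 2
    funext k
    refine Fin.cases rfl (fun k => ?_) k
    rfl

theorem nestedCommutator_smul [Algebra ℂ M] (p : ℕ) (c : Fin (p + 1) → ℂ) (R : Fin (p + 1) → M) :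
    nestedCommutator p (fun k => c k • R k) = (∏ k, c k) • nestedCommutator p R := by
  induction p with
  | zero => simp [nestedCommutator]
  | succ p ih =>
    rw [nestedCommutator, ih (fun k => c k.castSucc) (fun k => R k.castSucc), nestedCommutator,
      Fin.prod_univ_castSucc c]
    simp only [Ring.lie_def, smul_mul_smul_comm, smul_sub]
    rw [mul_comm (c (Fin.last (p + 1)))]

theorem nestedCommutator_kronecker {n m : Type*} [Fintype n] [DecidableEq n] [Fintype m]
    [DecidableEq m] (x : Matrix n n ℂ) (p : ℕ) (e : Fin (p + 1) → ℕ)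
    (R : Fin (p + 1) → Matrix m m ℂ) :
    nestedCommutator p (fun k => (x ^ e k) ⊗ₖ R k) = (x ^ ∑ k, e k) ⊗ₖ nestedCommutator p R := by
  induction p with
  | zero => simp [nestedCommutator]
  | succ p ih =>
    rw [nestedCommutator, ih (fun k => e k.castSucc) (fun k => R k.castSucc), nestedCommutator,
      Fin.sum_univ_castSucc e]
    simp only [Ring.lie_def, ← Matrix.mul_kronecker_mul, ← pow_add]
    rw [add_comm (e (Fin.last (p + 1)))]
    ext i j
    simp [mul_sub]

end Nested

/-- `adSum` over the summands of a list is a sum over words. -/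
theorem adSum_eq_sum_nestedCommutator {A ι : Type*} [CStarAlgebra A] [Fintype ι] {G : List A}
    {T : ι → A} (hG : ∀ φ : A → ℝ, (G.map φ).sum = ∑ i, φ (T i)) (p : ℕ) (X : A) :
    adSum (G.map fun g => (g, (1 : ℝ))) p X =
      ∑ w : Fin p → ι, ‖nestedCommutator p (Fin.cons X fun k => T (w k))‖ := by
  induction p generalizing X with
  | zero => simp [adSum, nestedCommutator]
  | succ p ih =>
    simp only [adSum, List.map_map, Function.comp_def, abs_one, one_mul]
    rw [hG fun g => adSum (G.map fun g => (g, (1 : ℝ))) p ⁅g, X⁆]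
    simp only [ih]
    rw [← (Fin.consEquiv fun _ : Fin (p + 1) => ι).sum_comp, Fintype.sum_prod_type]
    refine Finset.sum_congr rfl fun i _ => Finset.sum_congr rfl fun w _ => ?_
    rw [nestedCommutator_succ_eq]
    rfl

theorem sum_adSum_eq_sum_nestedCommutator {A ι : Type*} [CStarAlgebra A] [Fintype ι] {G : List A}
    {T : ι → A} (hG : ∀ φ : A → ℝ, (G.map φ).sum = ∑ i, φ (T i)) (p : ℕ) :
    (G.map (adSum (G.map fun g => (g, (1 : ℝ))) p)).sum =
      ∑ w : Fin (p + 1) → ι, ‖nestedCommutator p fun k => T (w k)‖ := by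
  rw [hG]
  simp only [adSum_eq_sum_nestedCommutator hG]
  rw [← (Fin.consEquiv fun _ : Fin (p + 1) => ι).sum_comp, Fintype.sum_prod_type]
  refine Finset.sum_congr rfl fun i _ => Finset.sum_congr rfl fun w _ => ?_
  congr 2
  funext k
  refine Fin.cases rfl (fun k => ?_) k
  rfl

/-! ### Operator norms of Kronecker products -/

section Kronecker

variable {n m : Type*} [Fintype n] [DecidableEq n] [Fintype m] [DecidableEq m]

/-- `x ↦ x ⊗ 1` as a star algebra homomorphism. -/
def kroneckerLeft : Matrix n n ℂ →⋆ₙₐ[ℂ] Matrix (n × m) (n × m) ℂ where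
  toFun x := x ⊗ₖ 1
  map_smul' c x := by rw [Matrix.smul_kronecker]; rfl
  map_zero' := Matrix.zero_kronecker _
  map_add' x y := Matrix.add_kronecker _ _ _
  map_mul' x y := by rw [← Matrix.mul_kronecker_mul, one_mul]
  map_star' x := by
    simp only [Matrix.star_eq_conjTranspose, Matrix.conjTranspose_kronecker,
      Matrix.conjTranspose_one]

/-- `X ↦ 1 ⊗ X` as a star algebra homomorphism. -/
def kroneckerRight : Matrix m m ℂ →⋆ₙₐ[ℂ] Matrix (n × m) (n × m) ℂ where
  toFun X := 1 ⊗ₖ X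
  map_smul' c x := by rw [Matrix.kronecker_smul]; rfl
  map_zero' := Matrix.kronecker_zero _
  map_add' x y := Matrix.kronecker_add _ _ _
  map_mul' x y := by rw [← Matrix.mul_kronecker_mul, one_mul]
  map_star' x := by
    simp only [Matrix.star_eq_conjTranspose, Matrix.conjTranspose_kronecker,
      Matrix.conjTranspose_one]

theorem norm_kronecker_one_le (x : Matrix n n ℂ) : ‖x ⊗ₖ (1 : Matrix m m ℂ)‖ ≤ ‖x‖ :=
  NonUnitalStarAlgHom.norm_apply_le (kroneckerLeft (m := m)) x

theorem norm_one_kronecker_le (X : Matrix m m ℂ) : ‖(1 : Matrix n n ℂ) ⊗ₖ X‖ ≤ ‖X‖ :=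
  NonUnitalStarAlgHom.norm_apply_le (kroneckerRight (n := n)) X

theorem norm_pow_kronecker_le (x : Matrix n n ℂ) (X : Matrix m m ℂ) (k : ℕ) :
    ‖(x ^ k) ⊗ₖ X‖ ≤ ‖x‖ ^ k * ‖X‖ := by
  induction k with
  | zero => simpa using norm_one_kronecker_le X
  | succ k ih =>
    have : (x ^ (k + 1)) ⊗ₖ X = (x ⊗ₖ (1 : Matrix m m ℂ)) * ((x ^ k) ⊗ₖ X) := by
      rw [← Matrix.mul_kronecker_mul, one_mul, pow_succ']
    rw [this, pow_succ', mul_assoc]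
    exact (norm_mul_le _ _).trans
      (mul_le_mul (norm_kronecker_one_le x) ih (norm_nonneg _) (norm_nonneg _))

end Kronecker

/-! ### The summands of the hybrid Hamiltonian -/

theorem Pauli.toMatrix_conjTranspose (P : Pauli) : P.toMatrixᴴ = P.toMatrix := by
  cases P <;> ext i j <;> fin_cases i <;> fin_cases j <;> simp [Pauli.toMatrix]

theorem PauliString.toMatrix_isHermitian {m : ℕ} (P : PauliString m) : P.toMatrix.IsHermitian := by
  ext x y
  simp only [PauliString.toMatrix, Matrix.conjTranspose_apply, Matrix.of_apply, star_prod]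
  refine Finset.prod_congr rfl fun q _ => ?_
  rw [← Matrix.conjTranspose_apply, Pauli.toMatrix_conjTranspose]

theorem PauliSum.term_isHermitian {m n : ℕ} (S : PauliSum m n) (i : Fin n) :
    (S.term i).IsHermitian := by
  rw [PauliSum.term, Matrix.IsHermitian, Matrix.conjTranspose_smul,
    (PauliString.toMatrix_isHermitian _).eq]
  simp

theorem positionTrunc_isHermitian (N : ℕ) : (positionTrunc N).IsHermitian := by
  have : position.IsHermitian := by
    rw [position, Matrix.IsHermitian, Matrix.conjTranspose_add, Matrix.conjTranspose_conjTranspose,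
      add_comm]
  exact this.submatrix _

theorem _root_.Matrix.IsHermitian.kronecker {n m : Type*} {x : Matrix n n ℂ} {X : Matrix m m ℂ}
    (hx : x.IsHermitian) (hX : X.IsHermitian) : (x ⊗ₖ X).IsHermitian := by
  rw [Matrix.IsHermitian, Matrix.conjTranspose_kronecker, hx.eq, hX.eq]

section Summands

variable {m NL NH : ℕ} (N : ℕ) (L : PauliSum m NL) (H : PauliSum m NH)

theorem summands_isHermitian : ∀ M ∈ summands N L H, M.IsHermitian := by
  intro M hM
  simp only [summands, List.mem_append, List.mem_ofFn] at hM
  rcases hM with ⟨i, rfl⟩ | ⟨j, rfl⟩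
  · exact (positionTrunc_isHermitian N).kronecker (L.term_isHermitian i)
  · exact Matrix.isHermitian_one.kronecker (H.term_isHermitian j)

/-- The summands, indexed by the letters of the commutator sums. -/
theorem sum_map_summands {M : Type*} [AddCommMonoid M] (φ : HybridOp N m → M) :
    ((summands N L H).map φ).sum = ∑ i : Fin NL ⊕ Fin NH,
      φ ((positionTrunc N ^ (if i.isLeft then 1 else 0)) ⊗ₖ Sum.elim L.term H.term i) := by
  simp [summands, List.sum_ofFn, List.map_ofFn, Function.comp_def]

theorem sum_summands :
    (summands N L H).sum = hybridHamiltonian N L.toMatrix H.toMatrix := by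
  have := sum_map_summands N L H id
  rw [List.map_id] at this
  rw [this, Fintype.sum_sum_type, hybridHamiltonian, PauliSum.toMatrix, PauliSum.toMatrix]
  ext i j
  simp [Matrix.sum_apply, Finset.mul_sum]

theorem pureSum_eq {n : ℕ} (p : ℕ) (S : PauliSum m n) :
    pureSum p S = ∑ i : Fin (p + 1) → Fin n, ‖nestedCommutator p fun k => S.term (i k)‖ := by
  refine Finset.sum_congr rfl fun i _ => ?_
  simp only [PauliSum.term, nestedCommutator_smul, norm_smul]
  rw [← ofReal_prod, norm_real, Real.norm_eq_abs]

theorem mixedSum_zero_le (p : ℕ) : mixedSum p 0 L H ≤ pureSum p H := by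
  rw [pureSum_eq]
  have hinj : Function.Injective
      fun (j : Fin (p + 1) → Fin NH) (k : Fin (p + 1)) => (Sum.inr (j k) : Fin NL ⊕ Fin NH) :=
    fun j j' h => funext fun k => Sum.inr_injective (congrFun h k)
  have himg := Finset.sum_image (s := Finset.univ) hinj.injOn
    (f := fun w => ‖nestedCommutator p fun k => Sum.elim L.term H.term (w k)‖)
  simp only [Sum.elim_inr] at himg
  rw [← himg]
  refine Finset.sum_le_sum_of_subset_of_nonneg ?_ fun _ _ _ => norm_nonneg _
  intro w hw
  simp only [Finset.mem_filter, Finset.mem_univ, true_and, Finset.card_eq_zero,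
    Finset.filter_eq_empty_iff, forall_const, Bool.not_eq_true, Sum.isLeft_eq_false,
    Sum.isRight_iff] at hw
  choose j hj using fun k => @hw k
  exact Finset.mem_image.2 ⟨j, Finset.mem_univ _, funext fun k => (hj k).symm⟩

theorem mixedSum_succ_le (p : ℕ) : mixedSum p (p + 1) L H ≤ pureSum p L := by
  rw [pureSum_eq]
  have hinj : Function.Injective
      fun (j : Fin (p + 1) → Fin NL) (k : Fin (p + 1)) => (Sum.inl (j k) : Fin NL ⊕ Fin NH) :=
    fun j j' h => funext fun k => Sum.inl_injective (congrFun h k)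
  have himg := Finset.sum_image (s := Finset.univ) hinj.injOn
    (f := fun w => ‖nestedCommutator p fun k => Sum.elim L.term H.term (w k)‖)
  simp only [Sum.elim_inl] at himg
  rw [← himg]
  refine Finset.sum_le_sum_of_subset_of_nonneg ?_ fun _ _ _ => norm_nonneg _
  intro w hw
  have hall : ∀ k, (w k).isLeft = true := by
    have h := (Finset.mem_filter.1 hw).2
    have h' := Finset.eq_univ_of_card _ (h.trans (Fintype.card_fin (p + 1)).symm)
    intro k
    have hk := Finset.mem_univ k
    rw [← h'] at hk
    exact (Finset.mem_filter.1 hk).2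
  simp only [Sum.isLeft_iff] at hall
  choose j hj using hall
  exact Finset.mem_image.2 ⟨j, Finset.mem_univ _, funext fun k => (hj k).symm⟩

/-- The commutators of the hybrid summands split as a power of the position operator, counting the
letters `A_i`, tensored with the commutator of the qubit letters. -/
theorem sum_norm_nestedCommutator_le_commutatorBound (p : ℕ) :
    ∑ w : Fin (p + 1) → Fin NL ⊕ Fin NH, ‖nestedCommutator p fun k =>
      (positionTrunc N ^ (if (w k).isLeft then 1 else 0)) ⊗ₖ Sum.elim L.term H.term (w k)‖ ≤
      commutatorBound N p L H := by
  have h1 : ∀ w : Fin (p + 1) → Fin NL ⊕ Fin NH, ‖nestedCommutator p fun k =>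
      (positionTrunc N ^ (if (w k).isLeft then 1 else 0)) ⊗ₖ Sum.elim L.term H.term (w k)‖ ≤
      positionNorm N ^ (Finset.univ.filter fun k => (w k).isLeft = true).card *
        ‖nestedCommutator p fun k => Sum.elim L.term H.term (w k)‖ := by
    intro w
    rw [nestedCommutator_kronecker (positionTrunc N) p (fun k => if (w k).isLeft then 1 else 0)
      fun k => Sum.elim L.term H.term (w k), Finset.card_filter]
    exact norm_pow_kronecker_le _ _ _
  refine (Finset.sum_le_sum fun w _ => h1 w).trans ?_
  have h2 := Finset.sum_fiberwise_of_maps_to (s := Finset.univ) (t := Finset.range (p + 2))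
    (g := fun w : Fin (p + 1) → Fin NL ⊕ Fin NH =>
      (Finset.univ.filter fun k => (w k).isLeft = true).card)
    (fun w _ => Finset.mem_range.2 (Nat.lt_succ_of_le
      ((Finset.card_filter_le _ _).trans_eq (by simp))))
    (fun w => positionNorm N ^ (Finset.univ.filter fun k => (w k).isLeft = true).card *
        ‖nestedCommutator p fun k => Sum.elim L.term H.term (w k)‖)
  rw [← h2]
  have h3 : ∀ a, ∑ w : Fin (p + 1) → Fin NL ⊕ Fin NH with
      (Finset.univ.filter fun k => (w k).isLeft = true).card = a,
      positionNorm N ^ (Finset.univ.filter fun k => (w k).isLeft = true).card *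
        ‖nestedCommutator p fun k => Sum.elim L.term H.term (w k)‖ =
      positionNorm N ^ a * mixedSum p a L H := by
    intro a
    rw [mixedSum, Finset.mul_sum]
    exact Finset.sum_congr rfl fun w hw => by rw [(Finset.mem_filter.1 hw).2]
  rw [Finset.sum_congr rfl fun a _ => h3 a, Finset.sum_range_succ, Finset.sum_range_succ',
    commutatorBound, pow_zero, one_mul]
  have h6 : ∑ a ∈ Finset.Icc 1 p, positionNorm N ^ a * mixedSum p a L H =
      ∑ a ∈ Finset.range p, positionNorm N ^ (a + 1) * mixedSum p (a + 1) L H := by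
    rw [Finset.range_eq_Ico, Finset.sum_Ico_add' (fun a => positionNorm N ^ a * mixedSum p a L H)]
    rfl
  have hx : 0 ≤ positionNorm N ^ (p + 1) := pow_nonneg (norm_nonneg _) _
  have h4 := mixedSum_zero_le L H p
  have h5 := mul_le_mul_of_nonneg_left (mixedSum_succ_le L H p) hx
  linarith

theorem sum_adSum_summands_le (p : ℕ) :
    ((summands N L H).map (adSum ((summands N L H).map fun g => (g, (1 : ℝ))) p)).sum ≤
      commutatorBound N p L H :=
  (sum_adSum_eq_sum_nestedCommutator (sum_map_summands N L H) p).trans_le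
    (sum_norm_nestedCommutator_le_commutatorBound N L H p)

theorem commutatorBound_nonneg (p : ℕ) : 0 ≤ commutatorBound N p L H :=
  (Finset.sum_nonneg fun _ _ => norm_nonneg _).trans
    (sum_norm_nestedCommutator_le_commutatorBound N L H p)

end Summands

/-- The number of steps is chosen so that the bound `M α t ^ (p + 1) / n ^ p` on the error, with
`M = absTime ^ (p + 1)`, is at most `ε`. The summand `1` keeps the constant positive. -/
theorem Formula.HasOrder.norm_sub_step_pow_le_of_le {F : Formula} {p : ℕ} (hp : 1 ≤ p)
    (hF : F.HasOrder p) (N : ℕ) {m NL NH : ℕ} (L : PauliSum m NL) (H : PauliSum m NH) {t ε : ℝ}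
    (ht : 0 ≤ t) (hε : 0 < ε) {n : ℕ} (hn : 1 ≤ n)
    (h : (F.absTime ^ (p + 1) + 1) ^ (1 / (p : ℝ)) * (t ^ (1 + 1 / (p : ℝ)) *
      (commutatorBound N p L H / ε) ^ (1 / (p : ℝ))) ≤ n) :
    ‖NormedSpace.exp ((-(I * (t : ℂ))) • hybridHamiltonian N L.toMatrix H.toMatrix)
      - F.step (summands N L H) (t / (n : ℝ)) ^ n‖ ≤ ε := by
  have hn0 : (0 : ℝ) < n := by exact_mod_cast hn
  have hp0 : (p : ℝ) ≠ 0 := by positivity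
  have hM := pow_nonneg F.absTime_nonneg (p + 1)
  have hα := commutatorBound_nonneg N L H p
  set M := F.absTime ^ (p + 1) with hMdef
  set α := commutatorBound N p L H with hαdef
  have hpow : (M + 1) * (t ^ (p + 1) * (α / ε)) ≤ (n : ℝ) ^ p := by
    have h1 := pow_le_pow_left₀ (by positivity) h p
    have hr : ∀ x : ℝ, 0 ≤ x → (x ^ (1 / (p : ℝ))) ^ p = x := fun x hx => by
      rw [one_div, Real.rpow_inv_natCast_pow hx (by lia)]
    rwa [Real.rpow_add_of_nonneg ht zero_le_one (by positivity), Real.rpow_one, mul_pow, mul_pow,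
      mul_pow, hr _ (by positivity), hr _ ht, hr _ (by positivity), ← pow_succ] at h1
  have h := hF.norm_sub_step_pow_le hp (summands_isHermitian N L H) ht hn
  have he : factorExp ((summands N L H).sum, 1) t =
      NormedSpace.exp ((-(I * (t : ℂ))) • hybridHamiltonian N L.toMatrix H.toMatrix) := by
    rw [factorExp, sum_summands, mul_one]
  rw [he] at h
  refine h.trans ?_
  calc _ ≤ M * α * (t ^ (p + 1) / (n : ℝ) ^ p) := by
        gcongr
        exact sum_adSum_summands_le N L H p
    _ = ε * (M * (t ^ (p + 1) * (α / ε))) / (n : ℝ) ^ p := by field_simp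
    _ ≤ ε * (n : ℝ) ^ p / (n : ℝ) ^ p := by
        gcongr
        refine le_trans ?_ hpow
        gcongr
        linarith
    _ = ε := by field_simp

/-! ### Leading error terms of product formulas -/

section Expansion

variable {A : Type*} [CStarAlgebra A]

/-- `S(s) = e^{-i v s H} + s ^ n (R + O(s))` as `s → 0`, with an analytic error term: `R` is the
leading error coefficient of `S` as an approximation of the evolution for time `v s`. -/
def HasExpansion (H : A) (n : ℕ) (S : ℝ → A) (v : ℝ) (R : A) : Prop :=
  ∃ h : ℝ → A, AnalyticAt ℝ h 0 ∧ h 0 = R ∧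
    ∀ᶠ s in 𝓝 0, S s = factorExp (H, 1) (v * s) + s ^ n • h s

variable {H : A} {n : ℕ} {S S' : ℝ → A} {v v' : ℝ} {R R' : A}

theorem factorExp_add (f : A × ℝ) (s t : ℝ) :
    factorExp f (s + t) = factorExp f s * factorExp f t := by
  let : NormedAlgebra ℚ A := NormedAlgebra.restrictScalars ℚ ℂ A
  rw [factorExp_eq, factorExp_eq, factorExp_eq, add_smul, NormedSpace.exp_add_of_commute]
  exact ((Commute.refl _).smul_left s).smul_right t

theorem HasExpansion.mul (hn : 1 ≤ n) (hS : HasExpansion H n S v R)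
    (hS' : HasExpansion H n S' v' R') :
    HasExpansion H n (fun s => S s * S' s) (v + v') (R + R') := by
  obtain ⟨h, ha, h0, he⟩ := hS
  obtain ⟨h', ha', h0', he'⟩ := hS'
  have hU : ∀ v : ℝ, AnalyticAt ℝ (fun s => factorExp (H, (1 : ℝ)) (v * s)) 0 := fun v =>
    (analyticAt_factorExp (H, 1) (v * 0)).comp_of_eq (analyticAt_const.mul analyticAt_id) rfl
  refine ⟨fun s => h s * factorExp (H, 1) (v' * s) + factorExp (H, 1) (v * s) * h' s +
    s ^ n • (h s * h' s), ?_, ?_, ?_⟩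
  · exact ((ha.mul (hU v')).add ((hU v).mul ha')).add ((analyticAt_id.pow n).smul (ha.mul ha'))
  · simp [factorExp_zero, h0, h0', zero_pow (Nat.one_le_iff_ne_zero.1 hn)]
  · filter_upwards [he, he'] with s h1 h2
    rw [h1, h2, add_mul v, factorExp_add]
    simp only [mul_add, add_mul, smul_add, smul_mul_assoc, mul_smul_comm]
    abel

theorem HasExpansion.comp_mul (hS : HasExpansion H n S v R) (u : ℝ) :
    HasExpansion H n (fun s => S (u * s)) (v * u) (u ^ n • R) := by
  obtain ⟨h, ha, h0, he⟩ := hS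
  have hc : AnalyticAt ℝ (fun s : ℝ => u * s) 0 := analyticAt_const.mul analyticAt_id
  refine ⟨fun s => u ^ n • h (u * s), ?_, by simp [h0], ?_⟩
  · exact analyticAt_const.smul (AnalyticAt.comp_of_eq ha hc (mul_zero u))
  · have ht : Tendsto (fun s : ℝ => u * s) (𝓝 0) (𝓝 0) :=
      (continuous_const_mul u).tendsto' 0 0 (mul_zero u)
    filter_upwards [ht.eventually he] with s hs
    rw [hs, mul_assoc, smul_smul, mul_pow, mul_comm (u ^ n)]

/-- A symmetric formula has no leading error term of even order `n`: the terms of `S(s)` and `S(-s)`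
add up to `2 R` in `S(s) S(-s) = 1`. -/
theorem HasExpansion.eq_zero_of_symmetric (hn : 1 ≤ n) (hev : Even n) (hS : HasExpansion H n S v R)
    (hsymm : ∀ s, S s * S (-s) = 1) : R = 0 := by
  obtain ⟨h, ha, h0, he⟩ := hS.mul hn (hS.comp_mul (-1))
  rw [hev.neg_one_pow, one_smul, ← two_smul ℝ R] at h0
  have hz : ∀ᶠ s in 𝓝[≠] (0 : ℝ), h s = 0 := by
    filter_upwards [nhdsWithin_le_nhds he, self_mem_nhdsWithin] with s hs (hs0 : s ≠ 0)
    have h1 := hsymm s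
    rw [neg_one_mul] at hs
    rw [hs, mul_neg_one, add_neg_cancel, zero_mul, factorExp_zero, add_eq_left] at h1
    exact (smul_eq_zero.1 h1).resolve_left (pow_ne_zero _ hs0)
  have hlim : h 0 = 0 := tendsto_nhds_unique
    (ha.continuousAt.tendsto.mono_left nhdsWithin_le_nhds)
    (tendsto_const_nhds.congr' (hz.mono fun s hs => hs.symm))
  rw [hlim] at h0
  exact (smul_eq_zero.1 h0.symm).resolve_left two_ne_zero

theorem HasExpansion.isBigO (hS : HasExpansion H n S 1 0) :
    (fun s => S s - factorExp (H, 1) s) =O[𝓝 0] fun s => s ^ (n + 1) := by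
  obtain ⟨h, ha, h0, he⟩ := hS
  have h1 : h =O[𝓝 0] fun s : ℝ => s := by
    simpa [h0] using ha.differentiableAt.isBigO_sub
  refine ((isBigO_refl (fun s : ℝ => s ^ n) (𝓝 0)).smul h1).congr' ?_ ?_
  · filter_upwards [he] with s hs
    rw [hs, one_mul, add_sub_cancel_left]
  · exact Eventually.of_forall fun s => by simp [pow_succ]

theorem exists_hasExpansion_of_isBigO (hS : AnalyticAt ℝ S 0)
    (hO : (fun s => S s - factorExp (H, 1) s) =O[𝓝 0] fun s => s ^ n) :
    ∃ R, HasExpansion H n S 1 R := by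
  obtain ⟨h, ha, he⟩ := exists_eq_pow_smul_of_isBigO (hS.sub (analyticAt_factorExp (H, 1) 0)) hO
  refine ⟨h 0, h, ha, rfl, ?_⟩
  filter_upwards [he] with s hs
  rw [← hs, one_mul]
  exact (add_sub_cancel _ _).symm

end Expansion

/-! ### The order of the standard formulas -/

theorem factorProd_scale {A : Type*} [CStarAlgebra A] (u : ℝ) (F : Formula) (G : List A) (s : ℝ) :
    factorProd ((F.scale u).factors G) s = factorProd (F.factors G) (u * s) := by
  have h1 : ∀ (c : ℝ) (l : List A), strangFactors (u * c) l =
      (strangFactors c l).map (Prod.map id (u * ·)) := by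
    intro c l
    fun_induction strangFactors c l with
    | case1 => rfl
    | case2 a => rfl
    | case3 a b l ih => simp [strangFactors, ih, mul_div_assoc]
  have h2 : (F.scale u).factors G = (F.factors G).map (Prod.map id (u * ·)) := by
    rw [Formula.scale, Formula.factors, Formula.factors, List.flatMap_map, List.map_flatMap]
    congr 1
    funext b
    cases b <;> simp [Block.scale, Block.factors, h1]
  rw [h2]
  induction F.factors G with
  | nil => rfl
  | cons f l ih =>
    rw [List.map_cons, factorProd_cons, ih, factorProd_cons, factorExp, factorExp]
    simp only [Prod.map_fst, Prod.map_snd, id]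
    congr 6
    ring

theorem factors_append {α : Type*} (F F' : Formula) (l : List α) :
    Formula.factors (F ++ F') l = F.factors l ++ F'.factors l := List.flatMap_append

theorem hasOrder_of_isBigO {F : Formula} {p : ℕ}
    (h : ∀ (d : ℕ) (G : List (Matrix (Fin d) (Fin d) ℂ)), (∀ M ∈ G, M.IsHermitian) →
      (fun s => factorProd (F.factors G) s - factorExp (G.sum, 1) s)
        =O[𝓝 0] fun s : ℝ => s ^ (p + 1)) : F.HasOrder p := by
  intro d G hG
  refine (h d G hG).congr_left fun s => ?_
  rw [Formula.step_eq_factorProd, factorExp, mul_one]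

/-- A formula is consistent as soon as its time fractions sum to `1`. -/
theorem hasOrder_one_of_sum_frac {F : Formula} (hF : (List.map Block.frac F).sum = 1) :
    F.HasOrder 1 := by
  refine hasOrder_of_isBigO fun d G hG => ?_
  have hd := (hasDerivAt_factorProd (Formula.factors_isSelfAdjoint (F := F) hG) 0).sub
    (hasDerivAt_factorExp (G.sum, 1) 0)
  have hgen : generator (F.factors G) 0 = (-(I * ((1 : ℝ) : ℂ))) • G.sum := by
    rw [generator_zero]
    have h := F.sum_factors (fun c => c) (fun c => add_halves c) (fun g => (-I) • g) G
    rw [hF, one_smul, ← List.smul_sum] at h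
    rw [ofReal_one, mul_one, ← h]
    congr 2
    funext f
    rw [← Complex.coe_smul, smul_smul]
    congr 1
    ring
  rw [factorProd_zero, factorExp_zero, mul_one, mul_one, hgen, sub_self] at hd
  have hO : (fun s => factorProd (F.factors G) s - factorExp (G.sum, 1) s)
      =O[𝓝 0] fun s : ℝ => s ^ 1 := by
    simpa [factorProd_zero, factorExp_zero] using hd.isBigO_sub
  obtain ⟨R, h, ha, h0, he⟩ := exists_hasExpansion_of_isBigO (analyticAt_factorProd _ 0) hO
  have hd' : HasDerivAt (fun s : ℝ => s • h s) (h 0) 0 := by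
    exact ((hasDerivAt_id (0 : ℝ)).smul ha.differentiableAt.hasDerivAt).congr_deriv (by simp)
  have hh : h 0 = 0 := by
    refine (hd'.congr_of_eventuallyEq ?_).unique hd
    filter_upwards [he] with s hs
    simp [hs]
  exact HasExpansion.isBigO ⟨h, ha, hh, he⟩

/-- The formula satisfies `S(s) S(-s) = 1`. -/
def Formula.IsSymmetric (F : Formula) : Prop :=
  ∀ (d : ℕ) (G : List (Matrix (Fin d) (Fin d) ℂ)) (s : ℝ),
    factorProd (F.factors G) s * factorProd (F.factors G) (-s) = 1

/-- A symmetric formula of odd order `p` has order `p + 1`. -/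
theorem Formula.HasOrder.succ_of_isSymmetric {F : Formula} {p : ℕ} (hF : F.HasOrder p)
    (hp : Odd p) (hs : F.IsSymmetric) : F.HasOrder (p + 1) := by
  refine hasOrder_of_isBigO fun d G hG => ?_
  obtain ⟨R, hR⟩ := exists_hasExpansion_of_isBigO (analyticAt_factorProd (F.factors G) 0)
    (hF.isBigO hG)
  obtain rfl := hR.eq_zero_of_symmetric (by lia) hp.add_one (hs d G)
  exact hR.isBigO

theorem strangFactors_reverse {α : Type*} (c : ℝ) (l : List α) :
    (strangFactors c l).reverse = strangFactors c l := by
  fun_induction strangFactors c l with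
  | case1 => rfl
  | case2 a => rfl
  | case3 a b l ih => simp [ih]

theorem isSymmetric_strang (c : ℝ) : Formula.IsSymmetric [Block.strang c] := by
  intro d G s
  have h := factorProd_mul_reverse_neg (strangFactors c G) s
  rw [strangFactors_reverse] at h
  simpa [Formula.factors, Block.factors] using h

/-- Suzuki's composition: four copies of `F` at time `u s` around one at time `(1 - 4 u) s`. -/
def Formula.suzukiStep (u : ℝ) (F : Formula) : Formula :=
  F.scale u ++ F.scale u ++ F.scale (1 - 4 * u) ++ F.scale u ++ F.scale u

theorem factorProd_suzukiStep {A : Type*} [CStarAlgebra A] (u : ℝ) (F : Formula) (G : List A)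
    (s : ℝ) : factorProd ((F.suzukiStep u).factors G) s =
      factorProd (F.factors G) (u * s) * (factorProd (F.factors G) (u * s) *
        (factorProd (F.factors G) ((1 - 4 * u) * s) * (factorProd (F.factors G) (u * s) *
          factorProd (F.factors G) (u * s)))) := by
  simp only [Formula.suzukiStep, factors_append, factorProd_append, factorProd_scale]

theorem Formula.IsSymmetric.suzukiStep {F : Formula} (hF : F.IsSymmetric) (u : ℝ) :
    (F.suzukiStep u).IsSymmetric := by
  intro d G s
  rw [factorProd_suzukiStep, factorProd_suzukiStep]
  have h1 := hF d G (u * s)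
  have h2 := hF d G ((1 - 4 * u) * s)
  have h1' : ∀ X, factorProd (F.factors G) (u * s) *
      (factorProd (F.factors G) (-(u * s)) * X) = X := fun X => by rw [← mul_assoc, h1, one_mul]
  have h2' : ∀ X, factorProd (F.factors G) ((1 - 4 * u) * s) *
      (factorProd (F.factors G) (-((1 - 4 * u) * s)) * X) = X := fun X => by
    rw [← mul_assoc, h2, one_mul]
  simp only [mul_neg, mul_assoc, h1', h2', h1]

/-- Leading error terms add up, that of `F` at time `v s` being `v ^ (p + 1)` times that of `F`. -/
theorem Formula.HasOrder.suzukiStep {F : Formula} {p : ℕ} (hF : F.HasOrder p) {u : ℝ}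
    (hu : 4 * u ^ (p + 1) + (1 - 4 * u) ^ (p + 1) = 0) : (F.suzukiStep u).HasOrder (p + 1) := by
  refine hasOrder_of_isBigO fun d G hG => ?_
  obtain ⟨R, hR⟩ := exists_hasExpansion_of_isBigO (analyticAt_factorProd (F.factors G) 0)
    (hF.isBigO hG)
  have hp : 1 ≤ p + 1 := by lia
  have hA := hR.comp_mul u
  have h := hA.mul hp (hA.mul hp ((hR.comp_mul (1 - 4 * u)).mul hp (hA.mul hp hA)))
  have hv : 1 * u + (1 * u + (1 * (1 - 4 * u) + (1 * u + 1 * u))) = 1 := by ring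
  have hr : u ^ (p + 1) • R + (u ^ (p + 1) • R + ((1 - 4 * u) ^ (p + 1) • R +
      (u ^ (p + 1) • R + u ^ (p + 1) • R))) = 0 := by
    rw [← zero_smul ℝ R, ← hu]
    module
  rw [hv, hr] at h
  simp only [factorProd_suzukiStep]
  exact h.isBigO

theorem suzuki_coefficient (k : ℕ) :
    let u : ℝ := 1 / (4 - (4 : ℝ) ^ (1 / (2 * (k + 1 : ℕ) + 1 : ℝ)))
    4 * u ^ (2 * (k + 1) + 1) + (1 - 4 * u) ^ (2 * (k + 1) + 1) = 0 := by
  intro u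
  set n := 2 * (k + 1) + 1 with hn
  set r : ℝ := (4 : ℝ) ^ (1 / (2 * (k + 1 : ℕ) + 1 : ℝ)) with hr
  have hnr : (2 * (k + 1 : ℕ) + 1 : ℝ) = (n : ℝ) := by rw [hn]; push_cast; ring
  have hrn : r ^ n = 4 := by
    rw [hr, hnr, one_div, Real.rpow_inv_natCast_pow (by norm_num) (by lia)]
  -- `r < 4`, so that the denominator of `u` is not zero
  have hr4 : r < 4 := by
    have h1 : (1 : ℝ) / n < 1 := by
      rw [div_lt_one (by positivity)]
      exact_mod_cast (by lia : 1 < n)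
    rw [hr, hnr]
    simpa using Real.rpow_lt_rpow_of_exponent_lt (x := 4) (by norm_num) h1
  have hu : u * (4 - r) = 1 := one_div_mul_cancel (by linarith)
  have h1 : 1 - 4 * u = -(r * u) := by linarith
  rw [h1, Odd.neg_pow ⟨k + 1, hn⟩, mul_pow, hrn, add_neg_cancel]

theorem suzuki_succ (k : ℕ) : suzuki (k + 1) =
    (suzuki k).suzukiStep (1 / (4 - (4 : ℝ) ^ (1 / (2 * (k + 1 : ℕ) + 1 : ℝ)))) := rfl

theorem suzuki_isSymmetric (k : ℕ) : (suzuki k).IsSymmetric := by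
  induction k with
  | zero => exact isSymmetric_strang 1
  | succ k ih => rw [suzuki_succ]; exact ih.suzukiStep _

theorem suzuki_hasOrder (k : ℕ) : (suzuki k).HasOrder (2 * (k + 1)) := by
  induction k with
  | zero =>
    exact (hasOrder_one_of_sum_frac (by simp [suzuki, Block.frac])).succ_of_isSymmetric
      odd_one (suzuki_isSymmetric 0)
  | succ k ih =>
    have h : (suzuki (k + 1)).HasOrder (2 * (k + 1) + 1) := by
      rw [suzuki_succ]
      exact ih.suzukiStep (suzuki_coefficient k)
    exact h.succ_of_isSymmetric ⟨k + 1, rfl⟩ (suzuki_isSymmetric (k + 1))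

theorem lieTrotter_hasOrder : lieTrotter.HasOrder 1 :=
  hasOrder_one_of_sum_frac (by simp [lieTrotter, Block.frac])

theorem numExp_append (F F' : Formula) :
    Formula.numExp (F ++ F') = F.numExp + F'.numExp := by
  rw [Formula.numExp, factors_append, List.length_append]; rfl

theorem numExp_scale (u : ℝ) (F : Formula) : (F.scale u).numExp = F.numExp := by
  rw [Formula.numExp, Formula.numExp, Formula.scale, Formula.factors, Formula.factors,
    List.flatMap_map, List.length_flatMap, List.length_flatMap]
  congr 2
  funext b
  cases b <;> rfl

theorem suzuki_numExp (k : ℕ) : (suzuki k).numExp = 3 * 5 ^ k := by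
  induction k with
  | zero => rfl
  | succ k ih =>
    rw [suzuki_succ, Formula.suzukiStep]
    simp only [numExp_append, numExp_scale, ih, pow_succ]
    ring

/-! ### Tensor products of single-qubit operators -/

section Tensor

variable {m : ℕ}

/-- The tensor product of single-qubit operators, one for each qubit. -/
def tensor (M : Fin m → Matrix (Fin 2) (Fin 2) ℂ) : Matrix (Bits m) (Bits m) ℂ :=
  Matrix.of fun x y => ∏ q, M q (x q) (y q)

theorem tensor_mul (M M' : Fin m → Matrix (Fin 2) (Fin 2) ℂ) :
    tensor M * tensor M' = tensor fun q => M q * M' q := by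
  ext x y
  simp only [tensor, Matrix.mul_apply, Matrix.of_apply, Finset.prod_univ_sum,
    Fintype.piFinset_univ, Finset.prod_mul_distrib]

theorem tensor_diagonal (d : Fin m → Fin 2 → ℂ) :
    tensor (fun q => Matrix.diagonal (d q)) = Matrix.diagonal fun y => ∏ q, d q (y q) := by
  ext x y
  by_cases h : x = y
  · subst h; simp [tensor]
  · obtain ⟨q, hq⟩ := Function.ne_iff.1 h
    rw [Matrix.diagonal_apply_ne _ h]
    exact Finset.prod_eq_zero (Finset.mem_univ q) (Matrix.diagonal_apply_ne _ hq)

theorem tensor_one : tensor (fun _ : Fin m => (1 : Matrix (Fin 2) (Fin 2) ℂ)) = 1 := by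
  simp only [← Matrix.diagonal_one, tensor_diagonal, Finset.prod_const_one]

theorem onQubit_eq_tensor (q : Fin m) (U : Matrix (Fin 2) (Fin 2) ℂ) :
    onQubit q U = tensor fun r => if r = q then U else 1 := by
  ext x y
  simp only [onQubit, tensor, Matrix.of_apply]
  rw [← Finset.mul_prod_erase _ _ (Finset.mem_univ q), if_pos rfl]
  split_ifs with h
  · rw [Finset.prod_eq_one, mul_one]
    intro r hr
    rw [if_neg (Finset.ne_of_mem_erase hr), h r (Finset.ne_of_mem_erase hr), Matrix.one_apply_eq]
  · push Not at h
    obtain ⟨r, hr, hne⟩ := h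
    rw [Finset.prod_eq_zero (Finset.mem_erase.2 ⟨hr, Finset.mem_univ r⟩), mul_zero]
    rw [if_neg hr, Matrix.one_apply_ne hne]

theorem onQubit_diagonal (q : Fin m) (d : Fin 2 → ℂ) :
    onQubit q (Matrix.diagonal d) = Matrix.diagonal fun y => d (y q) := by
  have : (fun r => if r = q then Matrix.diagonal d else 1) =
      fun r => Matrix.diagonal (if r = q then d else fun _ => 1) := by
    funext r
    split_ifs
    · rfl
    · exact Matrix.diagonal_one.symm
  rw [onQubit_eq_tensor, this, tensor_diagonal]
  congr 1
  funext y
  rw [Finset.prod_eq_single q (fun r _ hr => by simp [hr]) (by simp), if_pos rfl]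

theorem applyInOrder_onQubit (U : Fin m → Matrix (Fin 2) (Fin 2) ℂ) {l : List (Fin m)}
    (hl : l.Nodup) : applyInOrder (l.map fun q => onQubit q (U q)) =
      tensor fun q => if q ∈ l then U q else 1 := by
  induction l with
  | nil => simp [applyInOrder_nil, tensor_one]
  | cons q l ih =>
    rw [List.nodup_cons] at hl
    rw [List.map_cons, applyInOrder_cons, ih hl.2, onQubit_eq_tensor, tensor_mul]
    congr 1
    funext r
    by_cases hr : r = q
    · subst hr; simp [hl.1]
    · simp [hr]

end Tensor

/-! ### Parity operators and CNOT ladders -/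

section Parity

variable {m : ℕ}

/-- The sign `(-1)^b` of a bit: the diagonal of the Pauli matrix `Z`. -/
def bitSign (b : Fin 2) : ℂ := ![1, -1] b

theorem Pauli.toMatrix_Z : Pauli.Z.toMatrix = Matrix.diagonal bitSign := by
  ext i j; fin_cases i <;> fin_cases j <;> simp [Pauli.toMatrix, bitSign]

theorem bitSign_add (a b : Fin 2) : bitSign (a + b) = bitSign a * bitSign b := by
  fin_cases a <;> fin_cases b <;> simp [bitSign]

/-- The product of the Pauli matrices `Z_q` over `q ∈ T`. -/
def parity (T : Finset (Fin m)) : Matrix (Bits m) (Bits m) ℂ :=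
  Matrix.diagonal fun y => ∏ q ∈ T, bitSign (y q)

theorem parity_singleton (q : Fin m) : parity {q} = onQubit q Pauli.Z.toMatrix := by
  simp [parity, Pauli.toMatrix_Z, onQubit_diagonal]

theorem parity_eq_tensor (T : Finset (Fin m)) :
    parity T = tensor fun q => if q ∈ T then Pauli.Z.toMatrix else 1 := by
  have : (fun q => if q ∈ T then Pauli.Z.toMatrix else 1) =
      fun q => Matrix.diagonal (if q ∈ T then bitSign else fun _ => 1) := by
    funext q
    split_ifs
    · exact Pauli.toMatrix_Z
    · exact Matrix.diagonal_one.symm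
  rw [this, tensor_diagonal, parity]
  congr 1
  funext y
  rw [← Finset.prod_subset (Finset.subset_univ T) (fun q _ hq => by simp [hq])]
  exact Finset.prod_congr rfl fun q hq => by simp [hq]

/-- The action of a CNOT on bit strings. -/
def cnotMap (c t : Fin m) (y : Bits m) : Bits m := Function.update y t (y t + y c)

theorem cnotMap_cnotMap {c t : Fin m} (h : c ≠ t) (y : Bits m) :
    cnotMap c t (cnotMap c t y) = y := by
  have h2 : y t + y c + y c = y t := by
    generalize y t = a
    generalize y c = b
    fin_cases a <;> fin_cases b <;> rfl
  simp [cnotMap, Function.update_of_ne h, h2]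

theorem cnotMatrix_mul_self {c t : Fin m} (h : c ≠ t) :
    cnotMatrix c t * cnotMatrix c t = 1 := by
  ext x y
  change ∑ z, (if x = cnotMap c t z then (1 : ℂ) else 0) * (if z = cnotMap c t y then 1 else 0) = _
  simp [cnotMap_cnotMap h, Matrix.one_apply]

theorem cnotMatrix_mul_diagonal {c t : Fin m} (h : c ≠ t) (d : Bits m → ℂ) :
    cnotMatrix c t * Matrix.diagonal d =
      Matrix.diagonal (fun y => d (cnotMap c t y)) * cnotMatrix c t := by
  ext x y
  rw [Matrix.mul_diagonal, Matrix.diagonal_mul]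
  change (if x = cnotMap c t y then (1 : ℂ) else 0) * d y =
    d (cnotMap c t x) * (if x = cnotMap c t y then (1 : ℂ) else 0)
  split_ifs with hx
  · rw [hx, cnotMap_cnotMap h, one_mul, mul_one]
  · simp

/-- A CNOT whose target lies in the support of a parity operator adds its control to the
support. -/
theorem cnotMatrix_conj_parity {c t : Fin m} {T : Finset (Fin m)} (ht : t ∈ T) (hc : c ∉ T) :
    cnotMatrix c t * parity T * cnotMatrix c t = parity (insert c T) := by
  have hne : c ≠ t := fun h => hc (h ▸ ht)
  rw [parity, cnotMatrix_mul_diagonal hne, Matrix.mul_assoc, cnotMatrix_mul_self hne, mul_one,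
    parity]
  congr 1
  funext y
  rw [Finset.prod_insert hc, ← Finset.mul_prod_erase _ _ ht, ← Finset.mul_prod_erase T _ ht,
    Finset.prod_congr rfl fun q hq => by
      rw [cnotMap, Function.update_of_ne (Finset.ne_of_mem_erase hq)]]
  rw [cnotMap, Function.update_self, bitSign_add]
  ring

end Parity

/-! ### Conjugation by circuits without hybrid gates -/

theorem numCnot_append {m : ℕ} (c c' : Circuit m) :
    Circuit.numCnot (c ++ c') = c.numCnot + c'.numCnot := List.countP_append

theorem numHybrid_append {m : ℕ} (c c' : Circuit m) :
    Circuit.numHybrid (c ++ c') = c.numHybrid + c'.numHybrid := List.countP_append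

theorem toMatrix_append {m : ℕ} (N : ℕ) (c c' : Circuit m) :
    Circuit.toMatrix N (c ++ c') = c'.toMatrix N * c.toMatrix N := by
  rw [Circuit.toMatrix, List.map_append, applyInOrder_append]; rfl

theorem toMatrix_cons {m : ℕ} (N : ℕ) (g : Gate m) (c : Circuit m) :
    Circuit.toMatrix N (g :: c) = c.toMatrix N * g.toMatrix N := by
  rw [Circuit.toMatrix, List.map_cons, applyInOrder_cons]; rfl

theorem toMatrix_singleton {m : ℕ} (N : ℕ) (g : Gate m) :
    Circuit.toMatrix N [g] = g.toMatrix N := by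
  rw [toMatrix_cons]; exact one_mul _

/-- Some circuit without hybrid gates acts on the qubits as an invertible operator `W` with
`W Q W⁻¹ = P`, and both it and a circuit for `W⁻¹` have at most `k` CNOTs. -/
def Conjugates {m : ℕ} (N k : ℕ) (Q P : Matrix (Bits m) (Bits m) ℂ) : Prop :=
  ∃ (W W' : Matrix (Bits m) (Bits m) ℂ) (c c' : Circuit m),
    c.toMatrix N = 1 ⊗ₖ W ∧ c'.toMatrix N = 1 ⊗ₖ W' ∧ W * W' = 1 ∧ W * Q * W' = P ∧
    c.numCnot ≤ k ∧ c'.numCnot ≤ k ∧ c.numHybrid = 0 ∧ c'.numHybrid = 0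

section Conjugates

variable {m N k k' : ℕ} {Q P R : Matrix (Bits m) (Bits m) ℂ}

theorem Conjugates.refl (N : ℕ) (Q : Matrix (Bits m) (Bits m) ℂ) : Conjugates N 0 Q Q :=
  ⟨1, 1, [], [], by rw [Matrix.one_kronecker_one]; rfl, by rw [Matrix.one_kronecker_one]; rfl,
    by simp, by simp, le_rfl, le_rfl, rfl, rfl⟩

theorem Conjugates.trans (h : Conjugates N k Q P) (h' : Conjugates N k' P R) :
    Conjugates N (k + k') Q R := by
  obtain ⟨W, W', c, c', hc, hc', hW, hP, h1, h2, h3, h4⟩ := h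
  obtain ⟨V, V', d, d', hd, hd', hV, hR, h1', h2', h3', h4'⟩ := h'
  refine ⟨V * W, W' * V', c ++ d, d' ++ c', ?_, ?_, ?_, ?_, ?_, ?_, ?_, ?_⟩
  · rw [toMatrix_append, hc, hd, ← Matrix.mul_kronecker_mul, one_mul]
  · rw [toMatrix_append, hc', hd', ← Matrix.mul_kronecker_mul, one_mul]
  · rw [← mul_assoc, mul_assoc V, hW, mul_one, hV]
  · rw [← hR, ← hP]; simp only [mul_assoc]
  · rw [numCnot_append]; lia
  · rw [numCnot_append]; lia
  · rw [numHybrid_append, h3, h3']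
  · rw [numHybrid_append, h4, h4']

theorem conjugates_parity_insert {c t : Fin m} {T : Finset (Fin m)} (ht : t ∈ T) (hc : c ∉ T) :
    Conjugates N 1 (parity T) (parity (insert c T)) := by
  have hne : c ≠ t := fun h => hc (h ▸ ht)
  exact ⟨cnotMatrix c t, cnotMatrix c t, [Gate.cnot c t hne], [Gate.cnot c t hne],
    toMatrix_singleton _ _, toMatrix_singleton _ _, cnotMatrix_mul_self hne,
    cnotMatrix_conj_parity ht hc, le_rfl, le_rfl, rfl, rfl⟩

/-- A ladder of CNOTs with common target `t` turns `Z_t` into a parity operator. -/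
theorem conjugates_parity {t : Fin m} {T : Finset (Fin m)} (ht : t ∉ T) :
    Conjugates N T.card (onQubit t Pauli.Z.toMatrix) (parity (insert t T)) := by
  induction T using Finset.induction_on with
  | empty =>
    rw [insert_empty_eq, parity_singleton]
    exact Conjugates.refl N _
  | insert c T hc ih =>
    rw [Finset.mem_insert, not_or] at ht
    rw [Finset.card_insert_of_notMem hc, Finset.insert_comm]
    exact (ih ht.2).trans (conjugates_parity_insert (Finset.mem_insert_self t T)
      (by rw [Finset.mem_insert, not_or]; exact ⟨Ne.symm ht.1, hc⟩))

/-- Every Pauli matrix other than the identity is unitarily equivalent to `Z`. -/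
theorem Pauli.exists_unitary_conj (P : Pauli) : ∃ U : Matrix.unitaryGroup (Fin 2) ℂ,
    (U : Matrix (Fin 2) (Fin 2) ℂ) * (if P ≠ Pauli.I then Pauli.Z.toMatrix else 1) *
      ((star U : Matrix.unitaryGroup (Fin 2) ℂ) : Matrix (Fin 2) (Fin 2) ℂ) = P.toMatrix := by
  have h2 : (starRingEnd ℂ) 2 = 2 := map_ofNat _ 2
  cases P with
  | I => exact ⟨1, by simp [Pauli.toMatrix]⟩
  | X =>
    -- the Hadamard matrix, times the phase `e^{iπ/4}` to avoid square roots
    refine ⟨⟨((1 + Complex.I) / 2) • !![1, 1; 1, -1], ?_⟩, ?_⟩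
    · rw [Matrix.mem_unitaryGroup_iff]
      ext i j
      fin_cases i <;> fin_cases j <;>
        simp [Matrix.mul_apply, Fin.sum_univ_two, Matrix.star_apply, h2] <;> ring_nf <;>
        simp <;> norm_num
    · ext i j
      fin_cases i <;> fin_cases j <;>
        simp [Matrix.mul_apply, Fin.sum_univ_two, Matrix.star_apply, Pauli.toMatrix, h2] <;>
        ring_nf <;> simp <;> norm_num
  | Y =>
    -- the columns are eigenvectors of `Y`, with the same phase
    refine ⟨⟨((1 + Complex.I) / 2) • !![1, 1; Complex.I, -Complex.I], ?_⟩, ?_⟩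
    · rw [Matrix.mem_unitaryGroup_iff]
      ext i j
      fin_cases i <;> fin_cases j <;>
        simp [Matrix.mul_apply, Fin.sum_univ_two, Matrix.star_apply, h2] <;> ring_nf <;>
        simp <;> norm_num
    · ext i j
      fin_cases i <;> fin_cases j <;>
        simp [Matrix.mul_apply, Fin.sum_univ_two, Matrix.star_apply, Pauli.toMatrix, h2] <;>
        ring_nf <;> simp <;> norm_num <;> ring
  | Z => exact ⟨1, by simp [Pauli.toMatrix]⟩

theorem toMatrix_single_circuit (N : ℕ) (U : Fin m → Matrix.unitaryGroup (Fin 2) ℂ) :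
    Circuit.toMatrix N ((List.finRange m).map fun q => Gate.single q (U q)) =
      1 ⊗ₖ tensor fun q => (U q : Matrix (Fin 2) (Fin 2) ℂ) := by
  have h : ∀ l : List (Fin m), Circuit.toMatrix N (l.map fun q => Gate.single q (U q)) =
      1 ⊗ₖ applyInOrder (l.map fun q => onQubit q (U q : Matrix (Fin 2) (Fin 2) ℂ)) := by
    intro l
    induction l with
    | nil => rw [List.map_nil, List.map_nil, applyInOrder_nil, Matrix.one_kronecker_one]; rfl
    | cons q l ih =>
      rw [List.map_cons, toMatrix_cons, ih, List.map_cons, applyInOrder_cons, Gate.toMatrix,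
        ← Matrix.mul_kronecker_mul, one_mul]
  rw [h, applyInOrder_onQubit (fun q => (U q : Matrix (Fin 2) (Fin 2) ℂ)) (List.nodup_finRange m)]
  simp

/-- Single-qubit basis changes turn a parity operator into any Pauli string on its support. -/
theorem conjugates_pauliString (N : ℕ) (P : PauliString m) :
    Conjugates N 0 (parity (Finset.univ.filter fun q => P q ≠ Pauli.I)) P.toMatrix := by
  choose U hU using fun q => (P q).exists_unitary_conj
  have hcount : ∀ (p : Gate m → Bool) (V : Fin m → Matrix.unitaryGroup (Fin 2) ℂ),
      (∀ q W, p (Gate.single q W) = false) →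
      List.countP p ((List.finRange m).map fun q => Gate.single q (V q)) = 0 := by
    intro p V hp
    rw [List.countP_eq_zero]
    simp [hp]
  refine ⟨_, _, (List.finRange m).map fun q => Gate.single q (U q),
    (List.finRange m).map fun q => Gate.single q (star (U q)), toMatrix_single_circuit N _,
    toMatrix_single_circuit N _, ?_, ?_, (hcount _ _ fun _ _ => rfl).le,
    (hcount _ _ fun _ _ => rfl).le, hcount _ _ fun _ _ => rfl, hcount _ _ fun _ _ => rfl⟩
  · rw [tensor_mul, ← tensor_one]
    congr 1
    funext q
    exact Matrix.mem_unitaryGroup_iff.1 (U q).2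
  · rw [parity_eq_tensor, tensor_mul, tensor_mul]
    simp only [Finset.mem_filter, Finset.mem_univ, true_and, hU]
    rfl

theorem toMatrix_eq_one_of_weight_eq_zero {P : PauliString m} (hP : P.weight = 0) :
    P.toMatrix = 1 := by
  rw [PauliString.weight, Finset.card_eq_zero, Finset.filter_eq_empty_iff] at hP
  rw [← tensor_one, PauliString.toMatrix, tensor]
  congr 1
  funext x y
  refine Finset.prod_congr rfl fun q hq => ?_
  rw [not_not.1 (hP hq)]
  rfl

theorem exists_conjugates_of_weight_ne_zero (N : ℕ) {P : PauliString m} (hP : P.weight ≠ 0) :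
    ∃ q, Conjugates N (P.weight - 1) (onQubit q Pauli.Z.toMatrix) P.toMatrix := by
  obtain ⟨q, hq⟩ := Finset.card_ne_zero.1 hP
  refine ⟨q, ?_⟩
  have h := (conjugates_parity (N := N) (Finset.notMem_erase q _)).trans
    ((Finset.insert_erase hq).symm ▸ conjugates_pauliString N P)
  rwa [Finset.card_erase_of_mem hq] at h

theorem exp_kronecker_conj {W W' : Matrix (Bits m) (Bits m) ℂ} (hW : W * W' = 1)
    (x : Matrix (Fin N) (Fin N) ℂ) (a : ℂ) :
    NormedSpace.exp (a • (x ⊗ₖ (W * Q * W'))) =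
      (1 ⊗ₖ W) * NormedSpace.exp (a • (x ⊗ₖ Q)) * (1 ⊗ₖ W') := by
  let V : (HybridOp N m)ˣ := ⟨1 ⊗ₖ W, 1 ⊗ₖ W',
    by rw [← Matrix.mul_kronecker_mul, hW, one_mul, Matrix.one_kronecker_one],
    by rw [← Matrix.mul_kronecker_mul, mul_eq_one_comm.1 hW, one_mul,
      Matrix.one_kronecker_one]⟩
  have h := Matrix.exp_units_conj V (a • (x ⊗ₖ Q))
  change _ = (1 ⊗ₖ W) * NormedSpace.exp (a • (x ⊗ₖ Q)) * (1 ⊗ₖ W') at h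
  rw [← h]
  congr 1
  change _ = (1 ⊗ₖ W) * (a • (x ⊗ₖ Q)) * (1 ⊗ₖ W')
  rw [mul_smul_comm, smul_mul_assoc, ← Matrix.mul_kronecker_mul, ← Matrix.mul_kronecker_mul,
    one_mul, mul_one]

/-- A gate for `e^{a x ⊗ Q}` gives a circuit for `e^{a x ⊗ P}`, for every conjugate `P` of `Q`. -/
theorem Conjugates.exists_circuit (h : Conjugates N k Q P) {x : Matrix (Fin N) (Fin N) ℂ} {a : ℂ}
    {g : Gate m} (hg : g.toMatrix N = NormedSpace.exp (a • (x ⊗ₖ Q))) (hg' : g.isCnot = false) :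
    ∃ c : Circuit m, c.toMatrix N = NormedSpace.exp (a • (x ⊗ₖ P)) ∧ c.numCnot ≤ 2 * k ∧
      c.numHybrid = Circuit.numHybrid [g] := by
  obtain ⟨W, W', c, c', hc, hc', hW, rfl, h1, h2, h3, h4⟩ := h
  refine ⟨c' ++ ([g] ++ c), ?_, ?_, ?_⟩
  · rw [toMatrix_append, toMatrix_append, hc, hc', toMatrix_singleton, hg, exp_kronecker_conj hW]
  · have : Circuit.numCnot [g] = 0 := by simp [Circuit.numCnot, hg']
    rw [numCnot_append, numCnot_append]; lia
  · rw [numHybrid_append, numHybrid_append]; lia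

end Conjugates

/-! ### Circuits for product formulas -/

section Circuits

variable {m : ℕ} (N : ℕ)

theorem exists_circuit_position (P : PauliString m) (θ : ℝ) :
    ∃ c : Circuit m, c.toMatrix N =
        NormedSpace.exp ((-(I * (θ : ℂ))) • (positionTrunc N ⊗ₖ P.toMatrix)) ∧
      c.numCnot ≤ 2 * (P.weight - 1) ∧ c.numHybrid = 1 := by
  by_cases hP : P.weight = 0
  · refine ⟨[Gate.disp θ], ?_, Nat.zero_le _, rfl⟩
    rw [toMatrix_singleton, toMatrix_eq_one_of_weight_eq_zero hP, Gate.toMatrix]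
  · obtain ⟨q, hq⟩ := exists_conjugates_of_weight_ne_zero N hP
    exact hq.exists_circuit (g := Gate.condDisp q θ) rfl rfl

theorem exp_neg_I_mem_unitary (θ : ℝ) :
    (Matrix.diagonal fun b => Complex.exp (-(I * (θ : ℂ)) * bitSign b)) ∈
      Matrix.unitaryGroup (Fin 2) ℂ := by
  rw [Matrix.mem_unitaryGroup_iff, Matrix.star_eq_conjTranspose, Matrix.diagonal_conjTranspose,
    Matrix.diagonal_mul_diagonal, ← Matrix.diagonal_one]
  congr 1
  funext b
  rw [Pi.star_apply, star_def, ← Complex.exp_conj, ← Complex.exp_add, ← Complex.exp_zero]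
  congr 1
  fin_cases b <;> simp [bitSign]

theorem one_kronecker_diagonal (d : Bits m → ℂ) :
    (1 : Matrix (Fin N) (Fin N) ℂ) ⊗ₖ Matrix.diagonal d = Matrix.diagonal fun y => d y.2 := by
  rw [← Matrix.diagonal_one, Matrix.diagonal_kronecker_diagonal]
  simp

theorem exp_smul_one_kronecker_diagonal (a : ℂ) (d : Bits m → ℂ) :
    NormedSpace.exp (a • ((1 : Matrix (Fin N) (Fin N) ℂ) ⊗ₖ Matrix.diagonal d)) =
      1 ⊗ₖ Matrix.diagonal fun y => Complex.exp (a * d y) := by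
  rw [one_kronecker_diagonal, one_kronecker_diagonal, ← Matrix.diagonal_smul, Matrix.exp_diagonal]
  congr 1
  funext y
  rw [Pi.coe_exp, Complex.exp_eq_exp_ℂ]
  rfl

theorem exists_circuit_qubit (P : PauliString m) (θ : ℝ) :
    ∃ c : Circuit m, c.toMatrix N = NormedSpace.exp ((-(I * (θ : ℂ))) •
        ((1 : Matrix (Fin N) (Fin N) ℂ) ⊗ₖ P.toMatrix)) ∧
      c.numCnot ≤ 2 * (P.weight - 1) ∧ c.numHybrid = 0 := by
  by_cases hP : P.weight = 0
  · refine ⟨[Gate.phase θ], ?_, Nat.zero_le _, rfl⟩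
    rw [toMatrix_singleton, toMatrix_eq_one_of_weight_eq_zero hP, Gate.toMatrix,
      ← Matrix.diagonal_one (n := Bits m), exp_smul_one_kronecker_diagonal, one_kronecker_diagonal,
      ← Matrix.diagonal_one, ← Matrix.diagonal_smul]
    congr 1
    funext y
    simp
  · obtain ⟨q, hq⟩ := exists_conjugates_of_weight_ne_zero N hP
    refine hq.exists_circuit (g := Gate.single q ⟨_, exp_neg_I_mem_unitary θ⟩) ?_ rfl
    rw [Gate.toMatrix, Pauli.toMatrix_Z, onQubit_diagonal, onQubit_diagonal,
      exp_smul_one_kronecker_diagonal]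

variable {NL NH : ℕ} (L : PauliSum m NL) (H : PauliSum m NH)

/-- The Pauli weight of a summand, less one (truncated at `0`). -/
def letterLadder (i : Fin NL ⊕ Fin NH) : ℕ :=
  Sum.elim (fun i => (L.string i).weight - 1) (fun j => (H.string j).weight - 1) i

/-- The summands, indexed by the letters of the commutator sums. -/
def letterOp (i : Fin NL ⊕ Fin NH) : HybridOp N m :=
  Sum.elim (fun i => positionTrunc N ⊗ₖ L.term i) (fun j => 1 ⊗ₖ H.term j) i

/-- The letters, in the order of the summands. -/
def letters (NL NH : ℕ) : List (Fin NL ⊕ Fin NH) := List.ofFn Sum.inl ++ List.ofFn Sum.inr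

theorem summands_eq_map_letters : summands N L H = (letters NL NH).map (letterOp N L H) := by
  simp [summands, letters, letterOp, List.map_ofFn, Function.comp_def]

theorem sum_map_letters (φ : Fin NL ⊕ Fin NH → ℕ) :
    ((letters NL NH).map φ).sum = ∑ i, φ (Sum.inl i) + ∑ j, φ (Sum.inr j) := by
  simp [letters, List.map_ofFn, List.sum_ofFn]

theorem exists_circuit_factorExp (i : Fin NL ⊕ Fin NH) (c s : ℝ) :
    ∃ C : Circuit m, C.toMatrix N = factorExp (letterOp N L H i, c) s ∧
      C.numCnot ≤ 2 * letterLadder L H i ∧ C.numHybrid = if i.isLeft then 1 else 0 := by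
  have h : ∀ (x : Matrix (Fin N) (Fin N) ℂ) (α : ℝ) (P : Matrix (Bits m) (Bits m) ℂ),
      factorExp (x ⊗ₖ ((α : ℂ) • P), c) s =
        NormedSpace.exp ((-(I * ((s * c * α : ℝ) : ℂ))) • (x ⊗ₖ P)) := by
    intro x α P
    rw [factorExp, Matrix.kronecker_smul, smul_smul]
    congr 2
    push_cast
    ring
  rcases i with i | j
  · obtain ⟨C, h1, h2, h3⟩ := exists_circuit_position N (L.string i) (s * c * L.coeff i)
    exact ⟨C, h1.trans (h _ _ _).symm, h2, h3⟩
  · obtain ⟨C, h1, h2, h3⟩ := exists_circuit_qubit N (H.string j) (s * c * H.coeff j)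
    exact ⟨C, h1.trans (h _ _ _).symm, h2, h3⟩

theorem exists_circuit_factorProd (l : List ((Fin NL ⊕ Fin NH) × ℝ)) (s : ℝ) :
    ∃ C : Circuit m,
      C.toMatrix N = factorProd (l.map (Prod.map (letterOp N L H) id)) s ∧
      C.numCnot ≤ 2 * (l.map fun f => letterLadder L H f.1).sum ∧
      C.numHybrid = (l.map fun f => if f.1.isLeft then 1 else 0).sum := by
  induction l with
  | nil => exact ⟨[], rfl, le_rfl, rfl⟩
  | cons f l ih =>
    obtain ⟨C, h1, h2, h3⟩ := ih
    obtain ⟨D, h1', h2', h3'⟩ := exists_circuit_factorExp N L H f.1 f.2 s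
    refine ⟨D ++ C, ?_, ?_, ?_⟩
    · rw [toMatrix_append, h1, h1', List.map_cons, factorProd_cons]; rfl
    · rw [numCnot_append, List.map_cons, List.sum_cons]; lia
    · rw [numHybrid_append, List.map_cons, List.sum_cons, h3, h3']

/-- A formula uses every summand at most `numExp` times. -/
theorem sum_factors_le_numExp {α : Type*} (φ : α → ℕ) (F : Formula) (l : List α) :
    ((F.factors l).map fun f => φ f.1).sum ≤ F.numExp * (l.map φ).sum := by
  have hs : ∀ (c : ℝ) (l : List α),
      ((strangFactors c l).map fun f => φ f.1).sum ≤ 2 * (l.map φ).sum := by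
    intro c l
    fun_induction strangFactors c l with
    | case1 => simp
    | case2 a => simp; lia
    | case3 a b l ih =>
      simp only [List.map_cons, List.map_append, List.sum_cons, List.sum_append, List.map_nil,
        List.sum_nil, add_zero] at ih ⊢
      lia
  induction F with
  | nil => simp [Formula.factors]
  | cons b F ih =>
    have hb : ((b.factors l).map fun f => φ f.1).sum ≤
        Formula.numExp [b] * (l.map φ).sum := by
      cases b with
      | lie c =>
        simp only [Block.factors, List.map_map, Function.comp_def]
        exact Nat.le_mul_of_pos_left _ two_pos
      | lieRev c =>
        simp only [Block.factors, List.map_map, Function.comp_def, List.map_reverse,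
          List.sum_reverse]
        exact Nat.le_mul_of_pos_left _ two_pos
      | strang c => exact (hs c l).trans (Nat.mul_le_mul_right _ (by decide : 2 ≤ 3))
    have h1 : Formula.numExp (b :: F) = Formula.numExp [b] + Formula.numExp F := numExp_append [b] F
    have h2 : Formula.factors (b :: F) l = b.factors l ++ Formula.factors F l := rfl
    rw [h1, h2, List.map_append, List.sum_append, add_mul]
    lia

theorem exists_circuit_pow (C : Circuit m) (n : ℕ) : ∃ D : Circuit m,
    D.toMatrix N = C.toMatrix N ^ n ∧ D.numCnot = n * C.numCnot ∧
      D.numHybrid = n * C.numHybrid := by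
  induction n with
  | zero => exact ⟨[], by rw [pow_zero]; rfl, by rw [zero_mul]; rfl, by rw [zero_mul]; rfl⟩
  | succ n ih =>
    obtain ⟨D, h1, h2, h3⟩ := ih
    refine ⟨C ++ D, ?_, ?_, ?_⟩
    · rw [toMatrix_append, h1, pow_succ]
    · rw [numCnot_append, h2]; ring
    · rw [numHybrid_append, h3]; ring

theorem exists_circuit_step_pow (F : Formula) (s : ℝ) (n : ℕ) :
    ∃ c : Circuit m, c.toMatrix N = F.step (summands N L H) s ^ n ∧
      c.numCnot ≤ 2 * n * F.numExp * (L.ladderWeight + H.ladderWeight) ∧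
      c.numHybrid ≤ n * F.numExp * NL := by
  obtain ⟨C, h1, h2, h3⟩ := exists_circuit_factorProd N L H (F.factors (letters NL NH)) s
  obtain ⟨D, h4, h5, h6⟩ := exists_circuit_pow N C n
  have hcn := sum_factors_le_numExp (letterLadder L H) F (letters NL NH)
  have hhy := sum_factors_le_numExp
    (fun i : Fin NL ⊕ Fin NH => if i.isLeft then 1 else 0) F (letters NL NH)
  have e1 : ((letters NL NH).map (letterLadder L H)).sum = L.ladderWeight + H.ladderWeight :=
    sum_map_letters _
  have e2 : ((letters NL NH).map fun i => if i.isLeft then 1 else 0).sum = NL := by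
    rw [sum_map_letters]; simp
  rw [e1] at hcn
  rw [e2] at hhy
  refine ⟨D, ?_, ?_, ?_⟩
  · rw [h4, h1, Formula.step_eq_factorProd, summands_eq_map_letters, Formula.factors_map]
  · rw [h5]
    calc n * C.numCnot ≤ n * (2 * (F.numExp * (L.ladderWeight + H.ladderWeight))) := by
          gcongr; exact h2.trans (by gcongr)
      _ = _ := by ring
  · rw [h6, h3, mul_assoc]
    gcongr

end Circuits

end Hybrid

end

theorem theorem3 :
    (∀ (p : ℕ), 1 ≤ p → ∀ (F : Hybrid.Formula), F.HasOrder p →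
      ∃ C : ℝ, 0 < C ∧
        ∀ (N m NL NH : ℕ) (L : Hybrid.PauliSum m NL) (H : Hybrid.PauliSum m NH)
          (t ε : ℝ), 0 ≤ t → 0 < ε → ∀ (n : ℕ), 1 ≤ n →
          (C * (t ^ (1 + 1 / (p : ℝ)) *
              (Hybrid.commutatorBound N p L H / ε) ^ (1 / (p : ℝ))) ≤ (n : ℝ) →
            ‖NormedSpace.exp ((-(Complex.I * (t : ℂ))) •
                  Hybrid.hybridHamiltonian N L.toMatrix H.toMatrix)
                - F.step (Hybrid.summands N L H) (t / (n : ℝ)) ^ n‖ ≤ ε) ∧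
          ∃ c : Hybrid.Circuit m,
            c.toMatrix N = F.step (Hybrid.summands N L H) (t / (n : ℝ)) ^ n ∧
            c.numCnot ≤ 2 * n * F.numExp * (L.ladderWeight + H.ladderWeight) ∧
            c.numHybrid ≤ n * F.numExp * NL) ∧
    Hybrid.lieTrotter.HasOrder 1 ∧
    ∀ k : ℕ, 1 ≤ k →
      (Hybrid.suzuki (k - 1)).HasOrder (2 * k) ∧
      (Hybrid.suzuki (k - 1)).numExp = 3 * 5 ^ (k - 1) := by
  refine ⟨fun p hp F hF => ?_, Hybrid.lieTrotter_hasOrder, fun k hk => ?_⟩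
  · have hM := pow_nonneg F.absTime_nonneg (p + 1)
    refine ⟨(F.absTime ^ (p + 1) + 1) ^ (1 / (p : ℝ)), by positivity, ?_⟩
    intro N m NL NH L H t ε ht hε n hn
    exact ⟨fun h => hF.norm_sub_step_pow_le_of_le hp N L H ht hε hn h,
      Hybrid.exists_circuit_step_pow N L H F (t / n) n⟩
  · obtain ⟨k, rfl⟩ := Nat.exists_eq_add_of_le' hk
    exact ⟨Hybrid.suzuki_hasOrder k, Hybrid.suzuki_numExp k⟩
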